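/- Let $d\ge 2$ and $a\in(0,\infty)^d$. Let $E$ be the Euclidean space of pairs $(A,b)$ with $A$ a real symmetric $d\times d$ matrix such that $A1_d=0$ and $b\in\mathbb{R}^d$, with inner product $\langle (A,b),(A',b')\rangle=\sum_{i,j}A_{ij}A'_{ij}+\sum_k b_kb'_k$, and let \[ \Theta=\{(Q,l)\in E:\ Q \text{ positive semi-definite},\ \mathrm{Ker}\,Q=\mathrm{span}(1_d),\ l^T1_d<0\}. \] For $\theta=(Q,l)\in\Theta$, the Hüsler–Reiss Pareto distribution $\mathrm{HRPar}_a(\theta)$ has density \[ f_a(z;\theta)=\frac{1}{C_a(\theta)}\exp\Big(-\tfrac12(\log z)^TQ\log z+l^T\log z\Big)\prod_{i=1}^d z_i^{-1}\,1_{\{z\nleq a\}},\qquad z\in(0,\infty)^d, \] where $\log$ and $\le$ are taken componentwise and $C_a(\theta)$ is the normalization constant. For observations $z^{(1)},\dots,z^{(n)}\in(0,\infty)^d$ with $z^{(i)}\nleq a$, let $L_n(\theta)=\frac1n\sum_{i=1}^n\log f_a(z^{(i)};\theta)$. A maximum likelihood estimator (MLE) is a maximizer of $L_n$ over $\Theta$.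 Let \[ \overline T_n=\frac1n\sum_{i=1}^n T(z^{(i)})\in E,\qquad T(z)=\Big(-\tfrac12(\log z-\overline{\log z})(\log z-\overline{\log z})^T,\ \log z\Big),\qquad \overline{\log z}=d^{-1}(1_d^T\log z)\,1_d, \] and let \[ V_n=\frac1n\sum_{i=1}^n\log z^{(i)}(\log z^{(i)})^T-\Big(\frac1n\sum_{i=1}^n\log z^{(i)}\Big)\Big(\frac1n\sum_{i=1}^n\log z^{(i)}\Big)^T \] be the sample covariance matrix of the log-observations. (i) For every $n\ge1$ and all such observations, $L_n$ is strictly concave on $\Theta$. An MLE exists if and only if $v^TV_nv>0$ for all $v\in\mathbb{R}^d\setminus\{0\}$ with $v^T1_d=0$. If an MLE exists, it is the unique solution $\theta\in\Theta$ of the score equation $\frac{\partial\log C_a}{\partial\theta}(\theta)=\overline T_n$ (gradient in $E$). (ii) Let $\theta\in\Theta$ and let $Z^{(1)},Z^{(2)},\dots$ be independent random vectors with distribution $\mathrm{HRPar}_a(\theta)$. For every $n\ge d$, almost surely there is a unique MLE $\hat\theta_n$ based on $Z^{(1)},\dots,Z^{(n)}$. It is asymptotically normal and efficient: $\log C_a$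 is twice continuously differentiable at $\theta$, its Hessian \[ I(\theta)=\frac{\partial^2\log C_a}{\partial\theta\,\partial\theta^T}(\theta) \] is the Fisher information at $\theta$, that is $\langle u,I(\theta)v\rangle=\mathbb{E}_\theta\big[\langle u,\partial_\theta\log f_a(Z;\theta)\rangle\langle v,\partial_\theta\log f_a(Z;\theta)\rangle\big]$ for all $u,v\in E$, it is invertible, and \[ \sqrt n(\hat\theta_n-\theta)\xrightarrow{d}\mathcal N\big(0,I(\theta)^{-1}\big)\quad\text{on } E \text{ as } n\to\infty . \] -/

import Mathlib

open MeasureTheory ProbabilityTheory Filter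
open scoped RealInnerProductSpace Topology

noncomputable section

/-- The Euclidean space of pairs `(A, b)`, `A` a `d × d` real matrix and `b` a vector of `ℝ^d`, with
inner product `∑ i j, A i j * A' i j + ∑ k, b k * b' k`.  The coordinate `inl (i, j)` is `A i j`,
the coordinate `inr k` is `b k`. -/
abbrev HRAmbient (d : ℕ) : Type := EuclideanSpace ℝ ((Fin d × Fin d) ⊕ Fin d)

/-- The subspace of the pairs `(A, b)` with `A` symmetric and `A 1_d = 0`. -/
def hrSubspace (d : ℕ) : Submodule ℝ (HRAmbient d) where
  carrier := {x | (∀ i j, x (Sum.inl (i, j)) = x (Sum.inl (j, i))) ∧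
    ∀ i, ∑ j, x (Sum.inl (i, j)) = 0}
  add_mem' := by
    rintro x y ⟨hx, hx'⟩ ⟨hy, hy'⟩
    refine ⟨fun i j => ?_, fun i => ?_⟩
    · simp [hx i j, hy i j]
    · simp [Finset.sum_add_distrib, hx' i, hy' i]
  zero_mem' := by simp
  smul_mem' := by
    rintro c x ⟨hx, hx'⟩
    refine ⟨fun i j => ?_, fun i => ?_⟩
    · simp [hx i j]
    · simp [← Finset.mul_sum, hx' i]

/-- The Euclidean space `E` of the pairs `(A, b)` with `A` symmetric and `A 1_d = 0`, with the
inherited inner product. -/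
abbrev HRSpace (d : ℕ) : Type := ↥(hrSubspace d)

/-- The matrix component `A` of a point `(A, b)` of `E`. -/
def matPart {d : ℕ} (θ : HRSpace d) : Matrix (Fin d) (Fin d) ℝ :=
  Matrix.of fun i j => θ.1 (Sum.inl (i, j))

/-- The vector component `b` of a point `(A, b)` of `E`. -/
def vecPart {d : ℕ} (θ : HRSpace d) : Fin d → ℝ := fun k => θ.1 (Sum.inr k)

/-- The parameter set `Θ`: the pairs `(Q, l)` with `Q` symmetric positive semi-definite, with kernel
spanned by `1_d`, and `l^T 1_d < 0`. -/
def hrTheta (d : ℕ) : Set (HRSpace d) :=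
  {θ | (matPart θ).PosSemidef ∧
    LinearMap.ker (matPart θ).mulVecLin = Submodule.span ℝ {(fun _ => 1 : Fin d → ℝ)} ∧
    ∑ k, vecPart θ k < 0}

/-- The componentwise logarithm. -/
def logVec {d : ℕ} (z : Fin d → ℝ) : Fin d → ℝ := fun i => Real.log (z i)

/-- The support `{z ∈ (0,∞)^d : z ≰ a}`. -/
def hrRegion {d : ℕ} (a : Fin d → ℝ) : Set (Fin d → ℝ) := {z | (∀ i, 0 < z i) ∧ ¬ z ≤ a}

/-- `exp(-½ log z^T Q log z + l^T log z) ∏ z_i⁻¹`, for `θ = (Q, l)`. -/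
def hrKernel {d : ℕ} (θ : HRSpace d) (z : Fin d → ℝ) : ℝ :=
  Real.exp (-(1 / 2) * (logVec z ⬝ᵥ (matPart θ).mulVec (logVec z)) + vecPart θ ⬝ᵥ logVec z) *
    ∏ i, (z i)⁻¹

/-- The normalization constant `C_a(Q, l)`. -/
def hrC {d : ℕ} (a : Fin d → ℝ) (θ : HRSpace d) : ℝ := ∫ z in hrRegion a, hrKernel θ z

/-- The function `θ ↦ log C_a(θ)` on `E`. -/
def hrLogC {d : ℕ} (a : Fin d → ℝ) (θ : HRSpace d) : ℝ := Real.log (hrC a θ)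

/-- The Hüsler-Reiss Pareto density `f_a(z; θ)`. -/
def hrDensity {d : ℕ} (a : Fin d → ℝ) (θ : HRSpace d) (z : Fin d → ℝ) : ℝ :=
  (hrRegion a).indicator (fun z => (hrC a θ)⁻¹ * hrKernel θ z) z

/-- The Hüsler-Reiss Pareto distribution `HRPar_a(Q, l)`, for `θ = (Q, l)`. -/
def hrPareto {d : ℕ} (a : Fin d → ℝ) (θ : HRSpace d) : Measure (Fin d → ℝ) :=
  volume.withDensity fun z => ENNReal.ofReal (hrDensity a θ z)

/-- The (normalized) log-likelihood `L_n(θ; z⁽¹⁾, …, z⁽ⁿ⁾)`. -/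
def hrLogLik {d n : ℕ} (a : Fin d → ℝ) (z : Fin n → Fin d → ℝ) (θ : HRSpace d) : ℝ :=
  (1 / (n : ℝ)) * ∑ i, Real.log (hrDensity a θ (z i))

/-- `θ` is a maximum likelihood estimator: a maximizer of the log-likelihood over `Θ`. -/
def IsMLE {d n : ℕ} (a : Fin d → ℝ) (z : Fin n → Fin d → ℝ) (θ : HRSpace d) : Prop :=
  θ ∈ hrTheta d ∧ IsMaxOn (hrLogLik a z) (hrTheta d) θ

open Classical in
/-- The maximum likelihood estimator of a sample (`0` for a sample without one). -/
def mle {d n : ℕ} (a : Fin d → ℝ) (z : Fin n → Fin d → ℝ) : HRSpace d :=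
  if h : ∃ θ, IsMLE a z θ then h.choose else 0

/-- The vector `u - ū`, with `ū = d⁻¹ (1_d^T u) 1_d`. -/
def centered {d : ℕ} (u : Fin d → ℝ) : Fin d → ℝ := fun i => u i - (d : ℝ)⁻¹ * ∑ k, u k

theorem sum_centered {d : ℕ} (u : Fin d → ℝ) : ∑ i, centered u i = 0 := by
  rcases Nat.eq_zero_or_pos d with rfl | hd
  · simp
  · have : (d : ℝ) ≠ 0 := by positivity
    simp [centered, Finset.sum_sub_distrib, this]

/-- The natural sufficient statistic
`T(z) = (-½ (log z - mean) (log z - mean)^T, log z)`, a point of `E`. -/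
def suffStat {d : ℕ} (z : Fin d → ℝ) : HRSpace d :=
  ⟨WithLp.toLp 2 (Sum.elim
      (fun p => -(1 / 2) * (centered (logVec z) p.1 * centered (logVec z) p.2)) (logVec z)), by
    refine ⟨fun i j => ?_, fun i => ?_⟩
    · simp [mul_comm]
    · simp [← Finset.mul_sum, sum_centered]⟩

/-- The averaged sufficient statistic of a sample. -/
def meanSuffStat {d n : ℕ} (z : Fin n → Fin d → ℝ) : HRSpace d :=
  (1 / (n : ℝ)) • ∑ i, suffStat (z i)

/-- `θ` is a solution in `Θ` of the score equation `∂ log C_a / ∂θ (θ) = T̄_n`. -/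
def IsScoreSolution {d n : ℕ} (a : Fin d → ℝ) (z : Fin n → Fin d → ℝ) (θ : HRSpace d) : Prop :=
  θ ∈ hrTheta d ∧ HasGradientAt (hrLogC a) (meanSuffStat z) θ

/-- The sample covariance matrix `V_n` of the log-observations. -/
def logCov {d n : ℕ} (z : Fin n → Fin d → ℝ) : Matrix (Fin d) (Fin d) ℝ :=
  let m : Fin d → ℝ := (1 / (n : ℝ)) • ∑ i, logVec (z i)
  (1 / (n : ℝ)) • ∑ i, Matrix.vecMulVec (logVec (z i)) (logVec (z i)) - Matrix.vecMulVec m m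

/-- `v^T V v > 0` for all `v ≠ 0` with `v^T 1_d = 0`. -/
def CondPosDef {d : ℕ} (V : Matrix (Fin d) (Fin d) ℝ) : Prop :=
  ∀ v : Fin d → ℝ, v ≠ 0 → ∑ i, v i = 0 → 0 < v ⬝ᵥ V.mulVec v

/-- The score function `z ↦ ∂ log f_a(z; θ) / ∂θ`. -/
def hrScore {d : ℕ} (a : Fin d → ℝ) (θ : HRSpace d) (z : Fin d → ℝ) : HRSpace d :=
  gradient (fun η => Real.log (hrDensity a η z)) θ

/-- `J` is the Fisher information at `θ`, as an operator on `E`: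
`⟪u, J v⟫ = E_θ[⟪u, score⟫ ⟪v, score⟫]` for all `u, v`. -/
def IsFisherInformation {d : ℕ} (a : Fin d → ℝ) (θ : HRSpace d)
    (J : HRSpace d →L[ℝ] HRSpace d) : Prop :=
  (∀ᵐ z ∂(hrPareto a θ), DifferentiableAt ℝ (fun η => Real.log (hrDensity a η z)) θ) ∧
  ∀ u v : HRSpace d,
    Integrable (fun z => ⟪u, hrScore a θ z⟫ * ⟪v, hrScore a θ z⟫) (hrPareto a θ) ∧
    ∫ z, ⟪u, hrScore a θ z⟫ * ⟪v, hrScore a θ z⟫ ∂(hrPareto a θ) = ⟪u, J v⟫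

/-- `G` is the centered Gaussian distribution on `E` with covariance operator `S`. -/
def IsCenteredGaussian {d : ℕ} (G : Measure (HRSpace d)) (S : HRSpace d →L[ℝ] HRSpace d) : Prop :=
  IsGaussian G ∧ ∫ x, x ∂G = 0 ∧ ∀ u v : HRSpace d, covarianceBilin G u v = ⟪u, S v⟫

end

/-! In logarithmic coordinates `y` the Hüsler–Reiss Pareto laws form an exponential family with
statistic `suffStat` and base measure Lebesgue measure on `hrLogRegion a`. Everything rests on three
facts about this family. It is regular: the set of all `θ` with finite normalization is exactly Θ
(`natParam_hrBase`), which is open and convex. The statistic is nondegenerate, because a quadratic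
polynomial that is constant on a nonempty open set of this kind is trivial
(`nondegenerateStat_suffStat`). Finally, positivity of `V_n` on the hyperplane orthogonal to `1_d`
decides whether the likelihood attains its maximum.

For regular nondegenerate families, `log C` is smooth and strictly convex, with gradient the mean of
T and Hessian the covariance of T (`logPartition_gt_tangent`, `hasFDerivAt_meanParam`). Hence the
likelihood is strictly concave and its maximizers are the solutions of the score equation. A
maximizer for the averaged statistic `t` exists once every open half-space bounded by a hyperplane
through `t` is charged by the law of T (`exists_maximizer`).

If such a half-space were null, a polynomial in `y` would be maximal on the open region at every
observation. Its gradient vanishes there, and `V_n` then forces the polynomial to be zero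
(`hrBase_pos_of_condPosDef`). Conversely, if `v^T y` takes a constant value `c` on the sample, then
`-(v^T y - c)^2` has sample mean zero but strictly negative expectation under every parameter, so
the score equation has no solution (`condPosDef_of_meanParam_eq`). For `n ≥ d` the log-observations
are almost surely in general position, which gives the positivity.

The estimator is the inverse mean map applied to the averaged statistic. The central limit theorem,
the inverse function theorem and the delta method give a Gaussian limit with covariance `J⁻¹ J J⁻¹ =
J⁻¹`. -/

noncomputable section

/-! ### Exponential families: derivatives of the log-partition function and of the mean map. -/

section ExponentialFamily

set_option linter.unusedSectionVars false

variable {X : Type*} [MeasurableSpace X] {E : Type*} [NormedAddCommGroup E] [InnerProductSpace ℝ E]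
  {F : Type*} [NormedAddCommGroup F] [NormedSpace ℝ F]
  {ν : Measure X} {T : X → E}

/-- The natural parameter space of the exponential family with base measure `ν` and
statistic `T`. -/
def natParam (ν : Measure X) (T : X → E) : Set E :=
  {θ | Integrable (fun x => Real.exp ⟪θ, T x⟫) ν}

/-- The integral of `g` against the unnormalized density `exp ⟪θ, T⟫`. -/
def expMoment (ν : Measure X) (T : X → E) (g : X → F) (θ : E) : F :=
  ∫ x, Real.exp ⟪θ, T x⟫ • g x ∂ν

/-- `g` grows slower than every exponential of `‖T‖`. -/
def SubexpGrowth (T : X → E) (g : X → F) : Prop :=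
  ∀ ε > 0, ∃ K : ℝ, 0 ≤ K ∧ ∀ x, ‖g x‖ ≤ K * Real.exp (ε * ‖T x‖)

theorem subexpGrowth_const (T : X → E) (c : F) : SubexpGrowth T fun _ => c := fun ε hε =>
  ⟨‖c‖, norm_nonneg _, fun x => le_mul_of_one_le_right (norm_nonneg _)
    (Real.one_le_exp (by positivity))⟩

theorem norm_le_inv_mul_exp {ε : ℝ} (hε : 0 < ε) (t : ℝ) : t ≤ ε⁻¹ * Real.exp (ε * t) := by
  have h := Real.add_one_le_exp (ε * t)
  rw [inv_mul_eq_div, le_div_iff₀ hε]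
  linarith

theorem subexpGrowth_self (T : X → E) : SubexpGrowth T T := fun ε hε =>
  ⟨ε⁻¹, by positivity, fun x => norm_le_inv_mul_exp hε _⟩

theorem SubexpGrowth.bilin {T : X → E} {G H : Type*} [NormedAddCommGroup G] [NormedSpace ℝ G]
    [NormedAddCommGroup H] [NormedSpace ℝ H] {g : X → F} {h : X → G} {k : X → H}
    (hg : SubexpGrowth T g) (hh : SubexpGrowth T h) (hk : ∀ x, ‖k x‖ ≤ ‖g x‖ * ‖h x‖) :
    SubexpGrowth T k := by
  intro ε hε
  obtain ⟨K, hK, hK'⟩ := hg (ε / 2) (half_pos hε)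
  obtain ⟨L, hL, hL'⟩ := hh (ε / 2) (half_pos hε)
  refine ⟨K * L, by positivity, fun x => (hk x).trans ?_⟩
  calc ‖g x‖ * ‖h x‖ ≤ (K * Real.exp (ε / 2 * ‖T x‖)) * (L * Real.exp (ε / 2 * ‖T x‖)) :=
        mul_le_mul (hK' x) (hL' x) (norm_nonneg _) (by positivity)
    _ = K * L * (Real.exp (ε / 2 * ‖T x‖) * Real.exp (ε / 2 * ‖T x‖)) := by ring
    _ = K * L * Real.exp (ε * ‖T x‖) := by rw [← Real.exp_add]; ring_nf

theorem SubexpGrowth.smulRight {g : X → F} (hg : SubexpGrowth T g) :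
    SubexpGrowth T fun x => (innerSL ℝ (T x)).smulRight (g x) :=
  (subexpGrowth_self T).bilin hg fun x => by
    rw [ContinuousLinearMap.norm_smulRight_apply, innerSL_apply_norm]

variable [FiniteDimensional ℝ E]

/-- The norm is at most the sum of the absolute coordinates, and expanding the product of `exp (ε
xᵢ) + exp (-ε xᵢ)` gives one linear exponent per sign pattern. Exponentials of the norm are thus
controlled by finitely many nearby natural parameters. -/
theorem exp_norm_le_sum (ε : ℝ) (hε : 0 ≤ ε) : ∃ (S : Finset (Finset (Fin (Module.finrank ℝ E))))
    (w : Finset (Fin (Module.finrank ℝ E)) → E),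
    (∀ s, ‖w s‖ ≤ ε * Module.finrank ℝ E) ∧
    ∀ x : E, Real.exp (ε * ‖x‖) ≤ ∑ s ∈ S, Real.exp ⟪w s, x⟫ := by
  classical
  let b := stdOrthonormalBasis ℝ E
  refine ⟨Finset.univ.powerset, fun s => ∑ i, (if i ∈ s then ε else -ε) • b i, fun s => ?_,
    fun x => ?_⟩
  · refine (norm_sum_le _ _).trans ?_
    calc ∑ i, ‖(if i ∈ s then ε else -ε) • b i‖ ≤ ∑ i : Fin (Module.finrank ℝ E), ε := by
          refine Finset.sum_le_sum fun i _ => ?_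
          rw [norm_smul, b.norm_eq_one, mul_one]
          split_ifs <;> simp [abs_of_nonneg hε]
      _ = ε * Module.finrank ℝ E := by simp [mul_comm]
  · have h1 : ‖x‖ ≤ ∑ i, |⟪b i, x⟫| := by
      conv_lhs => rw [← b.sum_repr' x]
      refine (norm_sum_le _ _).trans (Finset.sum_le_sum fun i _ => ?_)
      rw [norm_smul, b.norm_eq_one, mul_one, Real.norm_eq_abs]
    calc Real.exp (ε * ‖x‖) ≤ Real.exp (∑ i, ε * |⟪b i, x⟫|) := by
          rw [← Finset.mul_sum]
          exact Real.exp_le_exp.2 (mul_le_mul_of_nonneg_left h1 hε)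
      _ = ∏ i, Real.exp (ε * |⟪b i, x⟫|) := Real.exp_sum _ _
      _ ≤ ∏ i, (Real.exp (ε * ⟪b i, x⟫) + Real.exp (-ε * ⟪b i, x⟫)) := by
          refine Finset.prod_le_prod (fun i _ => (Real.exp_pos _).le) fun i _ => ?_
          rcases abs_cases ⟪b i, x⟫ with ⟨h, _⟩ | ⟨h, _⟩
          · rw [h]; linarith [Real.exp_pos (-ε * ⟪b i, x⟫)]
          · rw [h, mul_neg, ← neg_mul]; linarith [Real.exp_pos (ε * ⟪b i, x⟫)]
      _ = _ := by
          rw [Finset.prod_add]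
          refine Finset.sum_congr rfl fun s _ => ?_
          rw [sum_inner, Real.exp_sum, ← Finset.prod_sdiff (Finset.subset_univ s), mul_comm]
          congr 1 <;> refine Finset.prod_congr rfl fun i hi => ?_
          · rw [inner_smul_left, if_neg (Finset.mem_sdiff.1 hi).2]; simp
          · rw [inner_smul_left, if_pos hi]; simp

variable [MeasurableSpace E] [BorelSpace E]

theorem integrable_exp_add_norm (hT : Measurable T) {θ : E} (hθ : natParam ν T ∈ 𝓝 θ) :
    ∃ ε > 0, Integrable (fun x => Real.exp (⟪θ, T x⟫ + ε * ‖T x‖)) ν := by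
  obtain ⟨r, hr, hball⟩ := Metric.mem_nhds_iff.1 hθ
  set n : ℝ := (Module.finrank ℝ E : ℝ)
  have hn : 0 ≤ n := Nat.cast_nonneg _
  -- The shifts `w s` have norm at most `r n / (n + 1) < r`, so all perturbed parameters stay in the
  -- ball; the `+ 1` also covers dimension 0.
  refine ⟨r / (n + 1), by positivity, ?_⟩
  obtain ⟨S, w, hw, hS⟩ := exp_norm_le_sum (E := E) (r / (n + 1)) (by positivity)
  have hint : Integrable (fun x => ∑ s ∈ S, Real.exp ⟪θ + w s, T x⟫) ν := by
    refine integrable_finsetSum _ fun s _ => ?_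
    have : θ + w s ∈ natParam ν T := hball <| by
      rw [mem_ball_iff_norm, add_sub_cancel_left]
      refine (hw s).trans_lt ?_
      rw [div_mul_eq_mul_div, div_lt_iff₀ (by positivity)]
      change r * n < r * (n + 1)
      nlinarith
    exact this
  refine hint.mono' (by fun_prop) (ae_of_all _ fun x => ?_)
  rw [Real.norm_eq_abs, abs_of_pos (Real.exp_pos _), Real.exp_add]
  simp_rw [inner_add_left, Real.exp_add, ← Finset.mul_sum]
  exact mul_le_mul_of_nonneg_left (hS _) (Real.exp_pos _).le

theorem SubexpGrowth.integrable (hT : Measurable T) {g : X → F} (hg : SubexpGrowth T g)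
    (hgm : AEStronglyMeasurable g ν) {θ : E} (hθ : natParam ν T ∈ 𝓝 θ) :
    Integrable (fun x => Real.exp ⟪θ, T x⟫ • g x) ν := by
  obtain ⟨ε, hε, hint⟩ := integrable_exp_add_norm hT hθ
  obtain ⟨K, hK, hK'⟩ := hg ε hε
  refine (hint.const_mul K).mono' ((by fun_prop : Measurable
    fun x => Real.exp ⟪θ, T x⟫).aestronglyMeasurable.smul hgm) (ae_of_all _ fun x => ?_)
  rw [norm_smul, Real.norm_eq_abs, abs_of_pos (Real.exp_pos _), Real.exp_add]
  nlinarith [hK' x, Real.exp_pos ⟪θ, T x⟫]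

/-- Differentiation under the integral. Of the available exponential margin `ε`, one half absorbs
the move of the parameter and the other half the growth of the integrand. The derivative is again an
`expMoment`, of an integrand that still grows subexponentially, so the formula iterates. -/
theorem hasFDerivAt_expMoment (hT : Measurable T) {g : X → F} (hg : SubexpGrowth T g)
    (hgm : AEStronglyMeasurable g ν) {θ : E} (hθ : natParam ν T ∈ 𝓝 θ) :
    HasFDerivAt (expMoment ν T g)
      (expMoment ν T (fun x => (innerSL ℝ (T x)).smulRight (g x)) θ) θ := by
  obtain ⟨ε, hε, hint⟩ := integrable_exp_add_norm hT hθ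
  obtain ⟨K, hK, hK'⟩ := hg.smulRight (ε / 2) (half_pos hε)
  have hm : AEStronglyMeasurable (fun x => (innerSL ℝ (T x)).smulRight (g x)) ν := by
    have h1 : AEStronglyMeasurable (fun x => innerSL ℝ (T x)) ν :=
      ((innerSL ℝ).continuous.measurable.comp hT).aestronglyMeasurable
    exact (ContinuousLinearMap.smulRightL ℝ E F).aestronglyMeasurable_comp₂ h1 hgm
  refine hasFDerivAt_integral_of_dominated_of_fderiv_le
    (F' := fun η x => Real.exp ⟪η, T x⟫ • (innerSL ℝ (T x)).smulRight (g x))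
    (bound := fun x => K * Real.exp (⟪θ, T x⟫ + ε * ‖T x‖))
    (Metric.ball_mem_nhds θ (half_pos hε)) (Eventually.of_forall fun η => ?_) ?_ ?_
    (ae_of_all _ fun x η hη => ?_) (hint.const_mul K) (ae_of_all _ fun x η _ => ?_)
  · exact (by fun_prop : Measurable fun x => Real.exp ⟪η, T x⟫).aestronglyMeasurable.smul hgm
  · exact hg.integrable hT hgm hθ
  · exact (by fun_prop : Measurable fun x => Real.exp ⟪θ, T x⟫).aestronglyMeasurable.smul hm
  · rw [norm_smul, Real.norm_eq_abs, abs_of_pos (Real.exp_pos _)]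
    have h1 : ⟪η, T x⟫ ≤ ⟪θ, T x⟫ + ε / 2 * ‖T x‖ := by
      have h2 : ⟪η - θ, T x⟫ ≤ ‖η - θ‖ * ‖T x‖ := real_inner_le_norm _ _
      rw [inner_sub_left] at h2
      have h3 : ‖η - θ‖ ≤ ε / 2 := (mem_ball_iff_norm.1 hη).le
      nlinarith [norm_nonneg (T x)]
    calc Real.exp ⟪η, T x⟫ * ‖(innerSL ℝ (T x)).smulRight (g x)‖
        ≤ Real.exp (⟪θ, T x⟫ + ε / 2 * ‖T x‖) * (K * Real.exp (ε / 2 * ‖T x‖)) :=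
          mul_le_mul (Real.exp_le_exp.2 h1) (hK' x) (norm_nonneg _) (Real.exp_pos _).le
      _ = K * (Real.exp (⟪θ, T x⟫ + ε / 2 * ‖T x‖) * Real.exp (ε / 2 * ‖T x‖)) := by ring
      _ = _ := by rw [← Real.exp_add]; ring_nf
  · have h1 : HasFDerivAt (fun η : E => ⟪η, T x⟫) (innerSL ℝ (T x)) η := by
      have := (innerSL ℝ (T x)).hasFDerivAt (x := η)
      refine this.congr_of_eventuallyEq (Eventually.of_forall fun y => ?_)
      simp [real_inner_comm]
    refine (h1.exp.smul_const (g x)).congr_fderiv ?_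
    ext v
    simp [mul_smul]

theorem aestronglyMeasurable_smulRight (hT : Measurable T) {g : X → F}
    (hgm : AEStronglyMeasurable g ν) :
    AEStronglyMeasurable (fun x => (innerSL ℝ (T x)).smulRight (g x)) ν :=
  (ContinuousLinearMap.smulRightL ℝ E F).aestronglyMeasurable_comp₂
    ((innerSL ℝ).continuous.measurable.comp hT).aestronglyMeasurable hgm

theorem contDiffOn_one_expMoment (hT : Measurable T) (ho : IsOpen (natParam ν T)) {g : X → F}
    (hg : SubexpGrowth T g) (hgm : AEStronglyMeasurable g ν) :
    ContDiffOn ℝ 1 (expMoment ν T g) (natParam ν T) := by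
  rw [show (1 : WithTop ℕ∞) = 0 + 1 from rfl, contDiffOn_succ_iff_fderiv_of_isOpen ho]
  refine ⟨fun θ hθ => (hasFDerivAt_expMoment hT hg hgm
    (ho.mem_nhds hθ)).differentiableAt.differentiableWithinAt, by simp, ?_⟩
  rw [contDiffOn_zero]
  refine ContinuousOn.congr (f := expMoment ν T fun x => (innerSL ℝ (T x)).smulRight (g x))
    (fun θ hθ => ?_)
    fun θ hθ => (hasFDerivAt_expMoment hT hg hgm (ho.mem_nhds hθ)).fderiv
  exact (hasFDerivAt_expMoment hT hg.smulRight (aestronglyMeasurable_smulRight hT hgm)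
    (ho.mem_nhds hθ)).continuousAt.continuousWithinAt

theorem contDiffOn_two_expMoment (hT : Measurable T) (ho : IsOpen (natParam ν T)) {g : X → F}
    (hg : SubexpGrowth T g) (hgm : AEStronglyMeasurable g ν) :
    ContDiffOn ℝ 2 (expMoment ν T g) (natParam ν T) := by
  rw [show (2 : WithTop ℕ∞) = 1 + 1 by norm_num, contDiffOn_succ_iff_fderiv_of_isOpen ho]
  refine ⟨fun θ hθ => (hasFDerivAt_expMoment hT hg hgm
    (ho.mem_nhds hθ)).differentiableAt.differentiableWithinAt, by simp, ?_⟩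
  exact (contDiffOn_one_expMoment hT ho hg.smulRight (aestronglyMeasurable_smulRight hT hgm)).congr
    fun θ hθ => (hasFDerivAt_expMoment hT hg hgm (ho.mem_nhds hθ)).fderiv

/-- The member with parameter `θ` of the exponential family with base measure `ν` and
statistic `T`. -/
def expFamily (ν : Measure X) (T : X → E) (θ : E) : Measure X := ν.tilted fun x => ⟪θ, T x⟫

/-- The log-partition function of the exponential family. -/
def logPartition (ν : Measure X) (T : X → E) (θ : E) : ℝ := Real.log (∫ x, Real.exp ⟪θ, T x⟫ ∂ν)

/-- The mean of the statistic under the parameter `θ`. -/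
def meanParam (ν : Measure X) (T : X → E) (θ : E) : E := ∫ x, T x ∂(expFamily ν T θ)

/-- The covariance operator of the statistic under the parameter `θ`. -/
def covOp (ν : Measure X) (T : X → E) (θ : E) : E →L[ℝ] E :=
  ∫ x, (innerSL ℝ (T x - meanParam ν T θ)).smulRight (T x - meanParam ν T θ) ∂(expFamily ν T θ)

theorem SubexpGrowth.integrable_expFamily (hT : Measurable T) {g : X → F} (hg : SubexpGrowth T g)
    (hgm : AEStronglyMeasurable g ν) {θ : E} (hθ : natParam ν T ∈ 𝓝 θ) :
    Integrable g (expFamily ν T θ) :=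
  (integrable_tilted_iff (show Integrable (fun x => Real.exp ⟪θ, T x⟫) ν from
    (mem_of_mem_nhds hθ : θ ∈ natParam ν T)) g).2 (hg.integrable hT hgm hθ)

theorem SubexpGrowth.sub {g h : X → F} (hg : SubexpGrowth T g) (hh : SubexpGrowth T h) :
    SubexpGrowth T fun x => g x - h x := fun ε hε => by
  obtain ⟨K, hK, hK'⟩ := hg ε hε
  obtain ⟨L, hL, hL'⟩ := hh ε hε
  refine ⟨K + L, by positivity, fun x => (norm_sub_le _ _).trans ?_⟩
  rw [add_mul]
  exact add_le_add (hK' x) (hL' x)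

theorem SubexpGrowth.inner_left {g : X → E} (hg : SubexpGrowth T g) (u : E) :
    SubexpGrowth T fun x => ⟪u, g x⟫ :=
  (subexpGrowth_const T u).bilin hg fun _ => norm_inner_le_norm _ _

variable [NeZero ν]

theorem isProbabilityMeasure_expFamily {θ : E} (hθ : θ ∈ natParam ν T) :
    IsProbabilityMeasure (expFamily ν T θ) := isProbabilityMeasure_tilted hθ

theorem partition_pos {θ : E} (hθ : θ ∈ natParam ν T) : 0 < ∫ x, Real.exp ⟪θ, T x⟫ ∂ν :=
  integral_exp_pos hθ

theorem expMoment_eq_smul {θ : E} (hθ : θ ∈ natParam ν T) (g : X → F) :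
    expMoment ν T g θ = (∫ x, Real.exp ⟪θ, T x⟫ ∂ν) • ∫ x, g x ∂(expFamily ν T θ) := by
  rw [expFamily, integral_tilted, ← integral_smul]
  refine integral_congr_ae (ae_of_all _ fun x => ?_)
  dsimp only
  rw [smul_smul, mul_div_cancel₀ _ (partition_pos hθ).ne']

theorem meanParam_eq {θ : E} (hθ : θ ∈ natParam ν T) :
    meanParam ν T θ = (expMoment ν T (fun _ => (1 : ℝ)) θ)⁻¹ • expMoment ν T T θ := by
  rw [expMoment_eq_smul hθ T, expMoment]
  simp only [smul_eq_mul, mul_one]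
  rw [smul_smul, inv_mul_cancel₀ (partition_pos hθ).ne', one_smul, meanParam]

theorem logPartition_eq (θ : E) :
    logPartition ν T θ = Real.log (expMoment ν T (fun _ => (1 : ℝ)) θ) := by
  simp [logPartition, expMoment]

theorem expMoment_one_ne_zero {θ : E} (hθ : θ ∈ natParam ν T) :
    expMoment ν T (fun _ => (1 : ℝ)) θ ≠ 0 := by
  simpa [expMoment] using (partition_pos hθ).ne'

theorem contDiffAt_logPartition (hT : Measurable T) (ho : IsOpen (natParam ν T)) {θ : E}
    (hθ : θ ∈ natParam ν T) : ContDiffAt ℝ 2 (logPartition ν T) θ := by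
  have h := (contDiffOn_two_expMoment (ν := ν) hT ho (subexpGrowth_const T (1 : ℝ))
    aestronglyMeasurable_const).contDiffAt (ho.mem_nhds hθ)
  exact (h.log (expMoment_one_ne_zero hθ)).congr_of_eventuallyEq
    (Eventually.of_forall fun η => logPartition_eq η)

theorem contDiffAt_meanParam (hT : Measurable T) (ho : IsOpen (natParam ν T)) {θ : E}
    (hθ : θ ∈ natParam ν T) : ContDiffAt ℝ 1 (meanParam ν T) θ := by
  have h := (contDiffOn_one_expMoment (ν := ν) hT ho (subexpGrowth_const T (1 : ℝ))
    aestronglyMeasurable_const).contDiffAt (ho.mem_nhds hθ)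
  have h' := (contDiffOn_one_expMoment (ν := ν) hT ho (subexpGrowth_self T)
    hT.aestronglyMeasurable).contDiffAt (ho.mem_nhds hθ)
  refine ((h.inv (expMoment_one_ne_zero hθ)).smul h').congr_of_eventuallyEq ?_
  filter_upwards [ho.mem_nhds hθ] with η hη using meanParam_eq hη

theorem expMoment_smulRight_apply (hT : Measurable T) {g : X → F} (hg : SubexpGrowth T g)
    (hgm : AEStronglyMeasurable g ν) {θ : E} (hθ : natParam ν T ∈ 𝓝 θ) (v : E) :
    expMoment ν T (fun x => (innerSL ℝ (T x)).smulRight (g x)) θ v =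
      (∫ x, Real.exp ⟪θ, T x⟫ ∂ν) • ∫ x, ⟪v, T x⟫ • g x ∂(expFamily ν T θ) := by
  have hm := aestronglyMeasurable_smulRight hT hgm
  rw [expMoment_eq_smul (mem_of_mem_nhds hθ), smul_apply,
    ContinuousLinearMap.integral_apply (hg.smulRight.integrable_expFamily hT hm hθ)]
  simp [real_inner_comm]

theorem hasGradientAt_logPartition (hT : Measurable T) {θ : E} (hθ : natParam ν T ∈ 𝓝 θ) :
    HasGradientAt (logPartition ν T) (meanParam ν T θ) θ := by
  have hθ' := mem_of_mem_nhds hθ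
  have h := hasFDerivAt_expMoment (ν := ν) hT (subexpGrowth_const T (1 : ℝ))
    aestronglyMeasurable_const hθ
  have h2 := (h.log (expMoment_one_ne_zero hθ')).congr_of_eventuallyEq
    (Eventually.of_forall fun η => logPartition_eq η)
  rw [hasGradientAt_iff_hasFDerivAt]
  refine h2.congr_fderiv ?_
  ext v
  have hint := (subexpGrowth_self T).integrable_expFamily hT hT.aestronglyMeasurable hθ
  rw [smul_apply, expMoment_smulRight_apply hT (subexpGrowth_const T (1 : ℝ))
    aestronglyMeasurable_const hθ, InnerProductSpace.toDual_apply_apply, meanParam,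
    real_inner_comm, ← integral_inner hint]
  simp only [expMoment, smul_eq_mul, mul_one]
  rw [inv_mul_cancel_left₀ (partition_pos hθ').ne']

theorem subexpGrowth_centered (c : E) : SubexpGrowth T fun x => T x - c :=
  (subexpGrowth_self T).sub (subexpGrowth_const T c)

theorem SubexpGrowth.mul {g h : X → ℝ} (hg : SubexpGrowth T g) (hh : SubexpGrowth T h) :
    SubexpGrowth T fun x => g x * h x := hg.bilin hh fun _ => norm_mul_le _ _

theorem inner_covOp (hT : Measurable T) {θ : E} (hθ : natParam ν T ∈ 𝓝 θ) (u v : E) :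
    ⟪u, covOp ν T θ v⟫ =
      ∫ x, ⟪u, T x - meanParam ν T θ⟫ * ⟪v, T x - meanParam ν T θ⟫ ∂(expFamily ν T θ) := by
  set m := meanParam ν T θ
  have hg := subexpGrowth_centered (T := T) m
  have hm : Measurable fun x => T x - m := hT.sub_const m
  have hi : Integrable (fun x => (innerSL ℝ (T x - m)).smulRight (T x - m)) (expFamily ν T θ) := by
    refine SubexpGrowth.integrable_expFamily hT (hg.bilin hg fun x => ?_) ?_ hθ
    · rw [ContinuousLinearMap.norm_smulRight_apply, innerSL_apply_norm]
    · exact aestronglyMeasurable_smulRight hm hm.aestronglyMeasurable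
  rw [covOp, ContinuousLinearMap.integral_apply hi, ← integral_inner (hi.apply_continuousLinearMap v)]
  refine integral_congr_ae (ae_of_all _ fun x => ?_)
  dsimp only
  rw [ContinuousLinearMap.smulRight_apply, inner_smul_right, innerSL_apply_apply, mul_comm,
    real_inner_comm v]

/-- The mean is the quotient of two exponential moments; the quotient rule produces `E[T ⊗ T] - m ⊗
m`, which is the covariance. The identity is checked after pairing with two vectors. -/
theorem hasFDerivAt_meanParam (hT : Measurable T) {θ : E} (hθ : natParam ν T ∈ 𝓝 θ) :
    HasFDerivAt (meanParam ν T) (covOp ν T θ) θ := by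
  have hθ' := mem_of_mem_nhds hθ
  have := isProbabilityMeasure_expFamily hθ'
  have hTi := (subexpGrowth_self T).integrable_expFamily (ν := ν) hT hT.aestronglyMeasurable hθ
  have h1 := hasFDerivAt_expMoment (ν := ν) hT (subexpGrowth_const T (1 : ℝ))
    aestronglyMeasurable_const hθ
  have h2 := hasFDerivAt_expMoment (ν := ν) hT (subexpGrowth_self T) hT.aestronglyMeasurable hθ
  have h3 : HasFDerivAt (fun η => (expMoment ν T (fun _ => (1 : ℝ)) η)⁻¹) _ θ :=
    (hasDerivAt_inv (expMoment_one_ne_zero hθ')).comp_hasFDerivAt θ h1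
  have h4 : meanParam ν T =ᶠ[𝓝 θ] fun η =>
      (expMoment ν T (fun _ => (1 : ℝ)) η)⁻¹ • expMoment ν T T η := by
    filter_upwards [eventually_mem_nhds_iff.2 hθ] with η hη using meanParam_eq (mem_of_mem_nhds hη)
  refine ((h3.smul h2).congr_of_eventuallyEq h4).congr_fderiv ?_
  ext1 v
  refine ext_inner_left ℝ fun u => ?_
  have hC := (partition_pos hθ').ne'
  have hu : ∫ x, ⟪u, T x⟫ ∂(expFamily ν T θ) = ⟪u, meanParam ν T θ⟫ := integral_inner hTi u
  have hv : ∫ x, ⟪v, T x⟫ ∂(expFamily ν T θ) = ⟪v, meanParam ν T θ⟫ := integral_inner hTi v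
  have iu := ((subexpGrowth_self T).inner_left u).integrable_expFamily (ν := ν) hT
    (by fun_prop : Measurable fun x => ⟪u, T x⟫).aestronglyMeasurable hθ
  have iv := ((subexpGrowth_self T).inner_left v).integrable_expFamily (ν := ν) hT
    (by fun_prop : Measurable fun x => ⟪v, T x⟫).aestronglyMeasurable hθ
  have iuv := (((subexpGrowth_self T).inner_left u).mul
    ((subexpGrowth_self T).inner_left v)).integrable_expFamily (ν := ν) hT
    (by fun_prop : Measurable fun x => ⟪u, T x⟫ * ⟪v, T x⟫).aestronglyMeasurable hθ
  have ivT : Integrable (fun x => ⟪v, T x⟫ • T x) (expFamily ν T θ) :=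
    (((subexpGrowth_self T).inner_left v).bilin (subexpGrowth_self T)
      fun x => (norm_smul _ _).le).integrable_expFamily hT
      (by fun_prop : Measurable fun x => ⟪v, T x⟫ • T x).aestronglyMeasurable hθ
  rw [inner_covOp hT hθ]
  have hR : ∫ x, ⟪u, T x - meanParam ν T θ⟫ * ⟪v, T x - meanParam ν T θ⟫ ∂(expFamily ν T θ) =
      ∫ x, ⟪u, T x⟫ * ⟪v, T x⟫ ∂(expFamily ν T θ) -
        ⟪u, meanParam ν T θ⟫ * ⟪v, meanParam ν T θ⟫ := by
    have : ∀ x, ⟪u, T x - meanParam ν T θ⟫ * ⟪v, T x - meanParam ν T θ⟫ =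
        ⟪u, T x⟫ * ⟪v, T x⟫ - ⟪v, meanParam ν T θ⟫ * ⟪u, T x⟫ -
          (⟪u, meanParam ν T θ⟫ * ⟪v, T x⟫ - ⟪u, meanParam ν T θ⟫ * ⟪v, meanParam ν T θ⟫) := by
      intro x; rw [inner_sub_right, inner_sub_right]; ring
    simp_rw [this]
    have i1 : Integrable (fun x => ⟪u, T x⟫ * ⟪v, T x⟫ - ⟪v, meanParam ν T θ⟫ * ⟪u, T x⟫)
        (expFamily ν T θ) := iuv.sub (iu.const_mul _)
    have i2 : Integrable (fun x => ⟪u, meanParam ν T θ⟫ * ⟪v, T x⟫ -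
        ⟪u, meanParam ν T θ⟫ * ⟪v, meanParam ν T θ⟫) (expFamily ν T θ) :=
      (iv.const_mul _).sub (integrable_const _)
    rw [integral_sub i1 i2, integral_sub iuv (iu.const_mul _), integral_sub (iv.const_mul _) (integrable_const _),
      integral_const_mul, integral_const_mul, hu, hv]
    simp
    ring
  have hL : ∫ x, ⟪u, T x⟫ * ⟪v, T x⟫ ∂(expFamily ν T θ) =
      ⟪u, ∫ x, ⟪v, T x⟫ • T x ∂(expFamily ν T θ)⟫ := by
    rw [← integral_inner ivT]
    simp [inner_smul_right, mul_comm]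
  rw [hR, hL]
  simp only [add_apply, smul_apply,
    ContinuousLinearMap.smulRight_apply]
  rw [expMoment_smulRight_apply hT (subexpGrowth_const T (1 : ℝ)) aestronglyMeasurable_const hθ,
    expMoment_smulRight_apply hT (subexpGrowth_self T) hT.aestronglyMeasurable hθ,
    expMoment_eq_smul hθ' T]
  simp only [expMoment, smul_eq_mul, mul_one, hv]
  rw [inner_add_right, inner_smul_right, inner_smul_right, inner_smul_right, inner_smul_right]
  change _ + _ * (_ * ⟪u, meanParam ν T θ⟫) = _
  field_simp
  ring

end ExponentialFamily

/-! ### Strict convexity, existence of maximizers and inversion of the mean map. -/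

section ExponentialFamilyMLE

set_option linter.unusedSectionVars false

variable {X : Type*} [MeasurableSpace X] {E : Type*} [NormedAddCommGroup E] [InnerProductSpace ℝ E]
  [FiniteDimensional ℝ E] [MeasurableSpace E] [BorelSpace E]
  {ν : Measure X} {T : X → E} [NeZero ν]

/-- No nontrivial linear functional of the statistic `T` is almost everywhere constant. -/
def NondegenerateStat (ν : Measure X) (T : X → E) : Prop :=
  ∀ u : E, u ≠ 0 → ∀ c : ℝ, ¬ ∀ᵐ x ∂ν, ⟪u, T x⟫ = c

theorem integral_inner_stat (hT : Measurable T) {θ : E} (hθ : natParam ν T ∈ 𝓝 θ) (u : E) :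
    ∫ x, ⟪u, T x⟫ ∂(expFamily ν T θ) = ⟪u, meanParam ν T θ⟫ :=
  integral_inner ((subexpGrowth_self T).integrable_expFamily hT hT.aestronglyMeasurable hθ) u

theorem integrable_inner_stat (hT : Measurable T) {θ : E} (hθ : natParam ν T ∈ 𝓝 θ) (u : E) :
    Integrable (fun x => ⟪u, T x⟫) (expFamily ν T θ) :=
  ((subexpGrowth_self T).inner_left u).integrable_expFamily hT
    (by fun_prop : Measurable fun x => ⟪u, T x⟫).aestronglyMeasurable hθ

theorem absolutelyContinuous_expFamily {θ : E} (hθ : θ ∈ natParam ν T) : ν ≪ expFamily ν T θ :=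
  absolutelyContinuous_tilted hθ

/-- The mean of `⟪u, T⟫` is strictly below any non-attained upper bound. -/
theorem inner_meanParam_lt (hT : Measurable T) (hnd : NondegenerateStat ν T) {θ u : E}
    (hθ : natParam ν T ∈ 𝓝 θ) (hu : u ≠ 0) {k : ℝ} (hk : ∀ᵐ x ∂ν, ⟪u, T x⟫ ≤ k) :
    ⟪u, meanParam ν T θ⟫ < k := by
  have hθ' := mem_of_mem_nhds hθ
  have := isProbabilityMeasure_expFamily hθ'
  have hi := integrable_inner_stat (ν := ν) hT hθ u
  have h0 : 0 ≤ᵐ[expFamily ν T θ] fun x => k - ⟪u, T x⟫ := by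
    filter_upwards [(tilted_absolutelyContinuous ν _).ae_le hk] with x hx using sub_nonneg.2 hx
  have h1 : ∫ x, (k - ⟪u, T x⟫) ∂(expFamily ν T θ) = k - ⟪u, meanParam ν T θ⟫ := by
    rw [integral_sub (integrable_const _) hi, integral_inner_stat hT hθ]
    simp
  have h2 := integral_nonneg_of_ae h0
  rw [h1] at h2
  refine lt_of_le_of_ne (sub_nonneg.1 h2) fun he => ?_
  rw [← he, sub_self, integral_eq_zero_iff_of_nonneg_ae] at h1
  · refine hnd u hu k ?_
    filter_upwards [(absolutelyContinuous_expFamily hθ').ae_le h1] with x hx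
    rw [← he]
    exact (sub_eq_zero.1 hx).symm
  · rwa [he]
  · exact (integrable_const _).sub hi

/-- Strict Jensen: the ratio of partition functions is the expectation under `θ` of `exp ⟪η - θ,
T⟫`. Equality would make `⟪η - θ, T⟫` almost everywhere constant. -/
theorem logPartition_gt_tangent (hT : Measurable T) (hnd : NondegenerateStat ν T) {θ η : E}
    (hθ : natParam ν T ∈ 𝓝 θ) (hη : η ∈ natParam ν T) (hne : η ≠ θ) :
    logPartition ν T θ + ⟪η - θ, meanParam ν T θ⟫ < logPartition ν T η := by
  have hθ' := mem_of_mem_nhds hθ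
  have := isProbabilityMeasure_expFamily hθ'
  set m := meanParam ν T θ
  set Y : X → ℝ := fun x => ⟪η - θ, T x⟫
  set k : ℝ := ⟪η - θ, m⟫
  have hi : Integrable Y (expFamily ν T θ) := integrable_inner_stat hT hθ _
  have hY : ∫ x, Y x ∂(expFamily ν T θ) = k := integral_inner_stat hT hθ _
  have hsum : ((fun x => ⟪θ, T x⟫) + Y) = fun x => ⟪η, T x⟫ := by
    funext x; simp [Y, inner_sub_left]
  have hexp : ∫ x, Real.exp (Y x) ∂(expFamily ν T θ) =
      (∫ x, Real.exp ⟪η, T x⟫ ∂ν) / ∫ x, Real.exp ⟪θ, T x⟫ ∂ν := by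
    rw [expFamily, integral_exp_tilted, hsum]
  have hei : Integrable (fun x => Real.exp (Y x)) (expFamily ν T θ) := by
    refine (integrable_tilted_iff (show Integrable (fun x => Real.exp ⟪θ, T x⟫) ν from hθ') _).2 ?_
    refine hη.congr (ae_of_all _ fun x => ?_)
    simp [Y, ← Real.exp_add, inner_sub_left]
  -- The gap between `exp` and its tangent line at the mean `k`; it is nonnegative and vanishes only
  -- where `Y = k`.
  set D : X → ℝ := fun x => Real.exp (Y x) - Real.exp k * (1 + (Y x - k))
  have hD0 : ∀ x, 0 ≤ D x := fun x => by
    have h := Real.add_one_le_exp (Y x - k)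
    have h2 : Real.exp (Y x) = Real.exp k * Real.exp (Y x - k) := by
      rw [← Real.exp_add]; ring_nf
    simp only [D]
    rw [h2, ← mul_sub]
    exact mul_nonneg (Real.exp_pos _).le (by linarith)
  have hlin : Integrable (fun x => Real.exp k * (1 + (Y x - k))) (expFamily ν T θ) :=
    ((integrable_const _).add (hi.sub (integrable_const _))).const_mul _
  have hDi : Integrable D (expFamily ν T θ) := hei.sub hlin
  have hlinI : ∫ x, Real.exp k * (1 + (Y x - k)) ∂(expFamily ν T θ) = Real.exp k := by
    have i1 : Integrable (fun x => Y x - k) (expFamily ν T θ) := hi.sub (integrable_const _)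
    rw [integral_const_mul, integral_add (integrable_const _) i1,
      integral_sub hi (integrable_const _), hY]
    simp
  have hDI : ∫ x, D x ∂(expFamily ν T θ) =
      (∫ x, Real.exp ⟪η, T x⟫ ∂ν) / (∫ x, Real.exp ⟪θ, T x⟫ ∂ν) - Real.exp k := by
    rw [integral_sub hei hlin, hlinI, hexp]
  have hpos : 0 < ∫ x, D x ∂(expFamily ν T θ) := by
    refine lt_of_le_of_ne (integral_nonneg hD0) fun h => ?_
    have hz := (integral_eq_zero_iff_of_nonneg hD0 hDi).1 h.symm
    refine hnd (η - θ) (sub_ne_zero.2 hne) k ?_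
    filter_upwards [(absolutelyContinuous_expFamily hθ').ae_le hz] with x hx
    by_contra hxk
    have h := Real.add_one_lt_exp (x := Y x - k) (sub_ne_zero.2 hxk)
    have h2 : Real.exp (Y x) = Real.exp k * Real.exp (Y x - k) := by
      rw [← Real.exp_add]; ring_nf
    have h3 : D x = 0 := hx
    simp only [D] at h3
    rw [h2, ← mul_sub] at h3
    rcases mul_eq_zero.1 h3 with h4 | h4
    · exact (Real.exp_pos _).ne' h4
    · linarith
  have hC := partition_pos hθ'
  rw [hDI, sub_pos, lt_div_iff₀ hC] at hpos
  have := Real.log_lt_log (by positivity) hpos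
  rw [Real.log_mul (Real.exp_pos _).ne' hC.ne', Real.log_exp] at this
  simp only [logPartition]
  linarith

theorem covOp_pos (hT : Measurable T) (hnd : NondegenerateStat ν T) {θ u : E}
    (hθ : natParam ν T ∈ 𝓝 θ) (hu : u ≠ 0) : 0 < ⟪u, covOp ν T θ u⟫ := by
  have hθ' := mem_of_mem_nhds hθ
  rw [inner_covOp hT hθ]
  set m := meanParam ν T θ
  have h0 : ∀ x, 0 ≤ ⟪u, T x - m⟫ * ⟪u, T x - m⟫ := fun x => mul_self_nonneg _
  refine lt_of_le_of_ne (integral_nonneg h0) fun h => ?_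
  have hi : Integrable (fun x => ⟪u, T x - m⟫ * ⟪u, T x - m⟫) (expFamily ν T θ) :=
    (((subexpGrowth_centered (T := T) m).inner_left u).mul
      ((subexpGrowth_centered (T := T) m).inner_left u)).integrable_expFamily hT
      (by fun_prop : Measurable fun x => ⟪u, T x - m⟫ * ⟪u, T x - m⟫).aestronglyMeasurable hθ
  have hz := (integral_eq_zero_iff_of_nonneg h0 hi).1 h.symm
  refine hnd u hu ⟪u, m⟫ ?_
  filter_upwards [(absolutelyContinuous_expFamily hθ').ae_le hz] with x hx
  have h1 : ⟪u, T x - m⟫ = 0 := mul_self_eq_zero.1 hx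
  rwa [inner_sub_right, sub_eq_zero] at h1

/-- The covariance operator of a nondegenerate statistic as a linear equivalence. -/
theorem exists_equiv_covOp (hT : Measurable T) (hnd : NondegenerateStat ν T) {θ : E}
    (hθ : natParam ν T ∈ 𝓝 θ) : ∃ J : E ≃L[ℝ] E, (J : E →L[ℝ] E) = covOp ν T θ := by
  have hinj : Function.Injective (covOp ν T θ : E →ₗ[ℝ] E) := by
    rw [← LinearMap.ker_eq_bot, LinearMap.ker_eq_bot']
    intro u hu
    by_contra hne
    have := covOp_pos hT hnd hθ hne
    rw [show covOp ν T θ u = 0 from hu, inner_zero_right] at this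
    exact lt_irrefl _ this
  refine ⟨(LinearEquiv.ofInjectiveEndo _ hinj).toContinuousLinearEquiv, ?_⟩
  ext x
  rfl

/-- If the means agreed at two points, the strict tangent inequalities at these points would add up
to a contradiction. -/
theorem meanParam_injOn (hT : Measurable T) (hnd : NondegenerateStat ν T)
    (ho : IsOpen (natParam ν T)) : Set.InjOn (meanParam ν T) (natParam ν T) := by
  intro θ hθ η hη h
  by_contra hne
  have h1 := logPartition_gt_tangent hT hnd (ho.mem_nhds hθ) hη (Ne.symm hne)
  have h2 := logPartition_gt_tangent hT hnd (ho.mem_nhds hη) hθ hne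
  rw [← h, ← neg_sub η θ, inner_neg_left] at h2
  linarith

theorem strictConvexOn_logPartition (hT : Measurable T) (hnd : NondegenerateStat ν T)
    (ho : IsOpen (natParam ν T)) (hc : Convex ℝ (natParam ν T)) :
    StrictConvexOn ℝ (natParam ν T) (logPartition ν T) := by
  refine ⟨hc, fun θ hθ η hη hne a b ha hb hab => ?_⟩
  set ζ := a • θ + b • η
  have hζ : ζ ∈ natParam ν T := hc hθ hη ha.le hb.le hab
  have hb' : b = 1 - a := by linarith
  have e1 : θ - ζ = b • (θ - η) := by
    simp only [ζ, hb']; module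
  have e2 : η - ζ = -(a • (θ - η)) := by
    simp only [ζ, hb']; module
  have hd : θ - η ≠ 0 := sub_ne_zero.2 hne
  have h1 := logPartition_gt_tangent hT hnd (ho.mem_nhds hζ) hθ (by
    rw [← sub_ne_zero, e1]; exact smul_ne_zero hb.ne' hd)
  have h2 := logPartition_gt_tangent hT hnd (ho.mem_nhds hζ) hη (by
    rw [← sub_ne_zero, e2]; exact neg_ne_zero.2 (smul_ne_zero ha.ne' hd))
  rw [e1, inner_smul_left] at h1
  rw [e2, inner_neg_left, inner_smul_left] at h2
  simp only [conj_trivial] at h1 h2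
  have h3 := mul_lt_mul_of_pos_left h1 ha
  have h4 := mul_lt_mul_of_pos_left h2 hb
  rw [smul_eq_mul, smul_eq_mul]
  have h5 : logPartition ν T ζ = a * logPartition ν T ζ + b * logPartition ν T ζ := by
    rw [← add_mul, hab, one_mul]
  rw [h5]
  linarith

/-- The Laplace transform of the statistic shifted by `t` attains its minimum. -/
theorem exists_isMinOn_laplace (hT : Measurable T) {t : E}
    (hne : (natParam ν T).Nonempty) (ht : ∀ u : E, u ≠ 0 → 0 < ν {x | 0 < ⟪u, T x - t⟫}) :
    ∃ θ, ∀ η, ∫⁻ x, ENNReal.ofReal (Real.exp ⟪θ, T x - t⟫) ∂ν ≤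
      ∫⁻ x, ENNReal.ofReal (Real.exp ⟪η, T x - t⟫) ∂ν := by
  -- With values in `[0, ∞]` the minimization runs over all of `E`; finiteness, hence membership in
  -- the natural parameter space, is recovered at the minimizer.
  set G : E → ENNReal := fun θ => ∫⁻ x, ENNReal.ofReal (Real.exp ⟪θ, T x - t⟫) ∂ν
  obtain ⟨v, -, hv, hvG⟩ := exists_seq_tendsto_sInf (S := Set.range G) ⟨G 0, 0, rfl⟩
    (OrderBot.bddBelow _)
  choose w hw using hvG
  set I := sInf (Set.range G)
  have hI : I ≠ ⊤ := by
    obtain ⟨θ, hθ⟩ := hne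
    have h1 : Integrable (fun x => Real.exp ⟪θ, T x - t⟫) ν := by
      have := hθ.mul_const (Real.exp (-⟪θ, t⟫))
      refine this.congr (ae_of_all _ fun x => ?_)
      dsimp only
      rw [inner_sub_right, Real.exp_sub, Real.exp_neg, div_eq_mul_inv]
    have h2 : G θ < ⊤ := by
      have := h1.2
      rw [hasFiniteIntegral_iff_ofReal (ae_of_all _ fun x => (Real.exp_pos _).le)] at this
      exact this
    exact ((sInf_le (Set.mem_range_self θ)).trans_lt h2).ne
  have hmeas : ∀ θ, Measurable fun x => ENNReal.ofReal (Real.exp ⟪θ, T x - t⟫) := by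
    intro θ; fun_prop
  have hGw : Tendsto (fun n => G (w n)) atTop (𝓝 I) := by simpa [hw] using hv
  have fatou : ∀ φ : ℕ → ℕ, StrictMono φ →
      ∫⁻ x, liminf (fun n => ENNReal.ofReal (Real.exp ⟪w (φ n), T x - t⟫)) atTop ∂ν ≤ I := by
    intro φ hφ
    refine (lintegral_liminf_le fun n => hmeas _).trans ?_
    exact (hGw.comp hφ.tendsto_atTop).liminf_eq.le
  -- If the minimizing sequence is bounded along a subsequence, Fatou's lemma makes any limit point
  -- a minimizer.
  by_cases hb : ∃ R, ∃ᶠ n in atTop, w n ∈ Metric.closedBall (0 : E) R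
  · obtain ⟨R, hR⟩ := hb
    obtain ⟨θ, -, φ, hφ, hlim⟩ :=
      tendsto_subseq_of_frequently_bounded Metric.isBounded_closedBall hR
    refine ⟨θ, fun η => le_trans ?_ (sInf_le (Set.mem_range_self η) : I ≤ G η)⟩
    refine le_trans (le_of_eq ?_) (fatou φ hφ)
    refine lintegral_congr fun x => ?_
    refine (Tendsto.liminf_eq ?_).symm
    refine (ENNReal.continuous_ofReal.tendsto _).comp
      ((Real.continuous_exp.tendsto _).comp ?_)
    exact (hlim.inner tendsto_const_nhds)
  -- Otherwise the norms tend to infinity and the directions subconverge to a unit vector `u`. On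
  -- the half-space `0 < ⟪u, T - t⟫`, which has positive measure, the integrand tends to infinity,
  -- so Fatou's lemma makes the infimum infinite.
  · exfalso
    push Not at hb
    have hnorm : Tendsto (fun n => ‖w n‖) atTop atTop := by
      refine tendsto_atTop.2 fun R => ?_
      filter_upwards [hb R] with n hn
      have : ¬ ‖w n‖ ≤ R := by simpa using hn
      exact (not_le.1 this).le
    obtain ⟨u, hu, φ, hφ, hlim⟩ := (isCompact_closedBall (0 : E) 1).tendsto_subseq
      (x := fun n => ‖w n‖⁻¹ • w n) fun n => by
        rw [mem_closedBall_zero_iff, norm_smul, norm_inv, norm_norm]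
        exact inv_mul_le_one
    have hnφ := hnorm.comp hφ.tendsto_atTop
    have hu1 : ‖u‖ = 1 := by
      refine tendsto_nhds_unique hlim.norm (tendsto_const_nhds.congr' ?_)
      filter_upwards [hnφ.eventually_gt_atTop 0] with n hn
      simp only [Function.comp_apply] at hn ⊢
      rw [norm_smul, norm_inv, norm_norm, inv_mul_cancel₀ hn.ne']
    have hu0 : u ≠ 0 := by
      rintro rfl; simp at hu1
    refine hI (top_le_iff.1 (le_trans (le_of_eq ?_) (fatou φ hφ)))
    have hS : MeasurableSet {x | 0 < ⟪u, T x - t⟫} :=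
      measurableSet_lt measurable_const (by fun_prop)
    refine (top_le_iff.1 (le_trans ?_ (setLIntegral_le_lintegral {x | 0 < ⟪u, T x - t⟫} _))).symm
    have : ∀ x ∈ {x | 0 < ⟪u, T x - t⟫},
        liminf (fun n => ENNReal.ofReal (Real.exp ⟪w (φ n), T x - t⟫)) atTop = ⊤ := by
      intro x hx
      refine Tendsto.liminf_eq (ENNReal.tendsto_ofReal_atTop.comp
        (Real.tendsto_exp_atTop.comp ?_))
      have h1 : Tendsto (fun n => ⟪‖w (φ n)‖⁻¹ • w (φ n), T x - t⟫) atTop (𝓝 ⟪u, T x - t⟫) :=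
        hlim.inner tendsto_const_nhds
      refine (hnφ.atTop_mul_pos hx h1).congr' ?_
      filter_upwards [hnφ.eventually_gt_atTop 0] with n hn
      simp only [Function.comp_apply] at hn ⊢
      rw [inner_smul_left, conj_trivial, mul_inv_cancel_left₀ hn.ne']
    rw [setLIntegral_congr_fun hS this, setLIntegral_const, ENNReal.top_mul (ht u hu0).ne']

theorem lintegral_laplace_eq {θ : E} (hθ : θ ∈ natParam ν T) (t : E) :
    ∫⁻ x, ENNReal.ofReal (Real.exp ⟪θ, T x - t⟫) ∂ν =
      ENNReal.ofReal (Real.exp (logPartition ν T θ - ⟪θ, t⟫)) := by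
  rw [Real.exp_sub, logPartition, Real.exp_log (partition_pos hθ), ← integral_div,
    ofReal_integral_eq_lintegral_ofReal (hθ.div_const _) (ae_of_all _ fun x => by positivity)]
  simp [inner_sub_right, Real.exp_sub]

/-- The logarithm of the Laplace transform of `T - t` is minus the log-likelihood, so its minimizer
is the maximizer sought. -/
theorem exists_maximizer (hT : Measurable T) {t : E}
    (hne : (natParam ν T).Nonempty) (ht : ∀ u : E, u ≠ 0 → 0 < ν {x | 0 < ⟪u, T x - t⟫}) :
    ∃ θ ∈ natParam ν T, ∀ η ∈ natParam ν T,
      ⟪η, t⟫ - logPartition ν T η ≤ ⟪θ, t⟫ - logPartition ν T θ := by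
  obtain ⟨θ, hθ⟩ := exists_isMinOn_laplace hT hne ht
  have hmem : θ ∈ natParam ν T := by
    obtain ⟨η, hη⟩ := hne
    have h1 := hθ η
    rw [lintegral_laplace_eq hη] at h1
    have h2 : Integrable (fun x => Real.exp ⟪θ, T x - t⟫) ν := by
      refine ⟨(by fun_prop : Measurable fun x =>
        Real.exp ⟪θ, T x - t⟫).aestronglyMeasurable, ?_⟩
      rw [hasFiniteIntegral_iff_ofReal (ae_of_all _ fun x => (Real.exp_pos _).le)]
      exact h1.trans_lt ENNReal.ofReal_lt_top
    have := h2.mul_const (Real.exp ⟪θ, t⟫)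
    refine this.congr (ae_of_all _ fun x => ?_)
    simp [← Real.exp_add, inner_sub_right]
  refine ⟨θ, hmem, fun η hη => ?_⟩
  have h := hθ η
  rw [lintegral_laplace_eq hη, lintegral_laplace_eq hmem,
    ENNReal.ofReal_le_ofReal_iff (Real.exp_pos _).le, Real.exp_le_exp] at h
  linarith

open Classical in
/-- The inverse of the mean parametrization, `0` outside of its range. -/
def meanParamInv (ν : Measure X) (T : X → E) (t : E) : E :=
  if h : ∃ θ ∈ natParam ν T, meanParam ν T θ = t then h.choose else 0

theorem meanParamInv_meanParam (hT : Measurable T) (hnd : NondegenerateStat ν T)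
    (ho : IsOpen (natParam ν T)) {θ : E} (hθ : θ ∈ natParam ν T) :
    meanParamInv ν T (meanParam ν T θ) = θ := by
  have h : ∃ η ∈ natParam ν T, meanParam ν T η = meanParam ν T θ := ⟨θ, hθ, rfl⟩
  rw [meanParamInv, dif_pos h]
  exact meanParam_injOn hT hnd ho h.choose_spec.1 hθ h.choose_spec.2

theorem hasStrictFDerivAt_meanParam (hT : Measurable T) (ho : IsOpen (natParam ν T)) {θ : E}
    (hθ : θ ∈ natParam ν T) : HasStrictFDerivAt (meanParam ν T) (covOp ν T θ) θ :=
  (contDiffAt_meanParam hT ho hθ).hasStrictFDerivAt'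
    (hasFDerivAt_meanParam hT (ho.mem_nhds hθ)) one_ne_zero

/-- Inverse function theorem: the mean map is C¹ with invertible derivative, and `meanParamInv` is a
left inverse of it near `θ`. -/
theorem hasStrictFDerivAt_meanParamInv (hT : Measurable T) (hnd : NondegenerateStat ν T)
    (ho : IsOpen (natParam ν T)) {θ : E} (hθ : θ ∈ natParam ν T) {J : E ≃L[ℝ] E}
    (hJ : (J : E →L[ℝ] E) = covOp ν T θ) :
    HasStrictFDerivAt (meanParamInv ν T) (J.symm : E →L[ℝ] E) (meanParam ν T θ) := by
  have h := hasStrictFDerivAt_meanParam hT ho hθ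
  rw [← hJ] at h
  refine h.to_local_left_inverse ?_
  filter_upwards [ho.mem_nhds hθ] with η hη using meanParamInv_meanParam hT hnd ho hη

theorem isOpen_image_meanParam (hT : Measurable T) (hnd : NondegenerateStat ν T)
    (ho : IsOpen (natParam ν T)) : IsOpen (meanParam ν T '' natParam ν T) := by
  rw [isOpen_iff_mem_nhds]
  rintro _ ⟨θ, hθ, rfl⟩
  obtain ⟨J, hJ⟩ := exists_equiv_covOp hT hnd (ho.mem_nhds hθ)
  have h := hasStrictFDerivAt_meanParam hT ho hθ
  rw [← hJ] at h
  rw [← h.map_nhds_eq_of_equiv]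
  exact image_mem_map (ho.mem_nhds hθ)

/-- The map is continuous on the open range of the mean map and constant off it. -/
theorem measurable_meanParamInv (hT : Measurable T) (hnd : NondegenerateStat ν T)
    (ho : IsOpen (natParam ν T)) : Measurable (meanParamInv ν T) := by
  classical
  have hM := isOpen_image_meanParam hT hnd ho
  have h : ContinuousOn (meanParamInv ν T) (meanParam ν T '' natParam ν T) := by
    rintro _ ⟨θ, hθ, rfl⟩
    obtain ⟨J, hJ⟩ := exists_equiv_covOp hT hnd (ho.mem_nhds hθ)
    exact (hasStrictFDerivAt_meanParamInv hT hnd ho hθ hJ).continuousAt.continuousWithinAt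
  have h2 := h.measurable_piecewise (g := fun _ => (0 : E)) continuousOn_const hM.measurableSet
  convert! h2 using 1
  funext t
  by_cases ht : t ∈ meanParam ν T '' natParam ν T
  · rw [Set.piecewise_eq_of_mem _ _ _ ht]
  · rw [Set.piecewise_eq_of_notMem _ _ _ ht, meanParamInv, dif_neg]
    exact ht

end ExponentialFamilyMLE

/-! ### Multivariate central limit theorem, delta method and asymptotics of the inverse mean map. -/

section AsymptoticNormality

set_option linter.unusedSectionVars false

variable {E : Type*} [NormedAddCommGroup E] [InnerProductSpace ℝ E]
  [FiniteDimensional ℝ E] [MeasurableSpace E] [BorelSpace E]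

/-- In an orthonormal basis `S` is a positive semidefinite matrix, and the standard construction on
Euclidean space is transported to `E`. -/
theorem exists_centeredGaussian (S : E →L[ℝ] E) (hsym : ∀ u v, ⟪S u, v⟫ = ⟪u, S v⟫)
    (hpos : ∀ u, 0 ≤ ⟪u, S u⟫) :
    ∃ G : Measure E, IsGaussian G ∧ ∫ x, x ∂G = 0 ∧ ∀ u v : E, covarianceBilin G u v = ⟪u, S v⟫ := by
  let b := stdOrthonormalBasis ℝ E
  let M : Matrix (Fin (Module.finrank ℝ E)) (Fin (Module.finrank ℝ E)) ℝ :=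
    Matrix.of fun i j => ⟪b i, S (b j)⟫
  have hM : ∀ u v : E, (b.repr u).ofLp ⬝ᵥ M.mulVec (b.repr v).ofLp = ⟪u, S v⟫ := by
    intro u v
    conv_rhs => rw [← b.sum_repr u, ← b.sum_repr v]
    simp only [map_sum, map_smul, sum_inner, inner_sum, inner_smul_left, inner_smul_right,
      dotProduct, Matrix.mulVec, M, Matrix.of_apply, conj_trivial, Finset.mul_sum]
    rw [Finset.sum_comm]
    refine Finset.sum_congr rfl fun i _ => Finset.sum_congr rfl fun j _ => ?_
    ring
  have hpsd : M.PosSemidef := by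
    refine Matrix.PosSemidef.of_dotProduct_mulVec_nonneg ?_ fun x => ?_
    · ext i j
      change ⟪b j, S (b i)⟫ = ⟪b i, S (b j)⟫
      rw [← hsym, real_inner_comm]
    · have h := hM (b.repr.symm (WithLp.toLp 2 x)) (b.repr.symm (WithLp.toLp 2 x))
      simp only [LinearIsometryEquiv.apply_symm_apply] at h
      rw [star_trivial, h]
      exact hpos _
  let L : EuclideanSpace ℝ (Fin (Module.finrank ℝ E)) →L[ℝ] E :=
    b.repr.symm.toContinuousLinearEquiv
  have hL : ∀ u, L.adjoint u = b.repr u := by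
    intro u
    refine ext_inner_left ℝ fun x => ?_
    rw [ContinuousLinearMap.adjoint_inner_right]
    change ⟪b.repr.symm x, u⟫ = _
    rw [← b.repr.inner_map_map, LinearIsometryEquiv.apply_symm_apply]
  refine ⟨(multivariateGaussian 0 M).map L, inferInstance, ?_, fun u v => ?_⟩
  · rw [integral_map (by fun_prop) (by fun_prop),
      L.integral_comp_comm (IsGaussian.integrable_fun_id)]
    simp
  · rw [covarianceBilin_map IsGaussian.memLp_two_id, hL, hL,
      covarianceBilin_multivariateGaussian hpsd, hM]

/-- The Cramér–Wold device, which reduces the vector-valued limit theorem to the real one. -/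
theorem charFun_map_eq_charFun_inner {Ω : Type*} [MeasurableSpace Ω] {P : Measure Ω} {Y : Ω → E}
    (hY : AEMeasurable Y P) (u : E) :
    charFun (P.map Y) u = charFun (P.map fun ω => ⟪u, Y ω⟫) 1 := by
  rw [charFun_apply, charFun_apply, integral_map hY (by fun_prop),
    integral_map (by fun_prop) (by fun_prop)]
  simp [real_inner_comm]

variable {Ω : Type*} [MeasurableSpace Ω] {P : Measure Ω} [IsProbabilityMeasure P]

/-- The multivariate central limit theorem. -/
theorem tendstoInDistribution_clt {X : ℕ → Ω → E} (hX : MemLp (X 0) 2 P) (hindep : iIndepFun X P)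
    (hident : ∀ i, IdentDistrib (X i) (X 0) P P) {G : Measure E} [IsGaussian G]
    (hG0 : ∫ x, x ∂G = 0)
    (hG : ∀ u, covarianceBilin G u u = Var[fun ω => ⟪u, X 0 ω⟫; P]) :
    TendstoInDistribution
      (fun (n : ℕ) ω => (√(n : ℝ))⁻¹ • (∑ k ∈ Finset.range n, X k ω - (n : ℝ) • P[X 0]))
      atTop id (fun _ => P) G := by
  have hm : ∀ i, AEMeasurable (X i) P := fun i => (hident i).aemeasurable_fst
  have hmY : ∀ n : ℕ, AEMeasurable
      (fun ω => (√(n : ℝ))⁻¹ • (∑ k ∈ Finset.range n, X k ω - (n : ℝ) • P[X 0])) P := fun n =>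
    ((Finset.aemeasurable_fun_sum _ fun i _ => hm i).sub_const _).const_smul _
  refine ⟨hmY, by fun_prop, ?_⟩
  refine ProbabilityMeasure.tendsto_iff_tendsto_charFun.2 fun u => ?_
  have hXi : Integrable (X 0) P := hX.integrable one_le_two
  set v := Var[fun ω => ⟪u, X 0 ω⟫; P]
  have h1 := tendstoInDistribution_inv_sqrt_mul_sum_sub (P := P)
    (X := fun i ω => ⟪u, X i ω⟫) (Y := id) (P' := gaussianReal 0 v.toNNReal)
    ⟨aemeasurable_id, Measure.map_id⟩
    (hX.const_inner u) (hindep.comp (fun _ x => ⟪u, x⟫) fun _ => by fun_prop)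
    (fun i => (hident i).comp (u := fun x => ⟪u, x⟫) (by fun_prop))
  have h2 := ProbabilityMeasure.tendsto_iff_tendsto_charFun.1 h1.tendsto 1
  have h3 : charFun (gaussianReal 0 v.toNNReal) 1 = charFun G u := by
    rw [charFun_gaussianReal, IsGaussian.charFun_eq', hG, Real.coe_toNNReal _ (variance_nonneg _ _)]
    simp [hG0]
  simp only [ProbabilityMeasure.coe_mk, Measure.map_id, h3] at h2 ⊢
  refine h2.congr fun n => ?_
  rw [charFun_map_eq_charFun_inner (hmY n)]
  congr 2
  funext ω
  rw [inner_smul_right, inner_sub_right, inner_sum, inner_smul_right, integral_inner hXi]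

/-- The delta method. -/
theorem tendstoInDistribution_deltaMethod {Y : ℕ → Ω → E} {t : E} {G : Measure E}
    [IsProbabilityMeasure G]
    (hY : TendstoInDistribution (fun (n : ℕ) ω => √(n : ℝ) • (Y n ω - t)) atTop id (fun _ => P) G)
    (hm : ∀ n, AEMeasurable (Y n) P) (hlim : ∀ᵐ ω ∂P, Tendsto (fun n => Y n ω) atTop (𝓝 t))
    {g : E → E} (hg : Measurable g) {A : E →L[ℝ] E} (hA : HasFDerivAt g A t) :
    TendstoInDistribution (fun (n : ℕ) ω => √(n : ℝ) • (g (Y n ω) - g t)) atTop A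
      (fun _ => P) G := by
  -- The normalized Taylor remainder, equal to 0 at `h = 0`. With `W = √n (Y - t)` the quantity of
  -- interest is `A W + ‖W‖ q (Y - t)`, and `q (Y - t)` tends to 0 in probability, so Slutsky's
  -- theorem applies.
  set q : E → E := fun h => ‖h‖⁻¹ • (g (t + h) - g t - A h)
  have hqm : Measurable q := by fun_prop
  have hq0 : Tendsto q (𝓝 0) (𝓝 0) := by
    have := hasFDerivAt_iff_isLittleO_nhds_zero.1 hA
    rw [tendsto_zero_iff_norm_tendsto_zero]
    refine this.norm_norm.tendsto_div_nhds_zero.congr fun h => ?_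
    rw [norm_smul, norm_inv, norm_norm, inv_mul_eq_div]
  have hQ : TendstoInMeasure P (fun n ω => q (Y n ω - t)) atTop fun _ => 0 := by
    refine tendstoInMeasure_of_tendsto_ae
      (fun n => (hqm.comp_aemeasurable ((hm n).sub_const t)).aestronglyMeasurable) ?_
    filter_upwards [hlim] with ω hω
    refine hq0.comp ?_
    simpa using hω.sub_const t
  have h := hY.continuous_comp_prodMk_of_tendstoInMeasure_const
    (g := fun p : E × E => A p.1 + ‖p.1‖ • p.2) (by fun_prop) hQ
    (fun n => hqm.comp_aemeasurable ((hm n).sub_const t))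
  refine h.congr (fun n => ae_of_all _ fun ω => ?_) (ae_of_all _ fun w => by simp)
  simp only [q, map_smul, norm_smul, add_sub_cancel, Real.norm_eq_abs,
    abs_of_nonneg (Real.sqrt_nonneg _)]
  rcases eq_or_ne (Y n ω) t with h0 | h0
  · simp [h0]
  · have : ‖Y n ω - t‖ ≠ 0 := norm_ne_zero_iff.2 (sub_ne_zero.2 h0)
    rw [smul_smul, mul_assoc, mul_inv_cancel₀ this, mul_one, ← smul_add]
    congr 1
    abel

section MaximumLikelihood

variable {X : Type*} [MeasurableSpace X] {ν : Measure X} {T : X → E} [NeZero ν]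

theorem covOp_symm (hT : Measurable T) {θ : E} (hθ : natParam ν T ∈ 𝓝 θ) (u v : E) :
    ⟪covOp ν T θ u, v⟫ = ⟪u, covOp ν T θ v⟫ := by
  rw [real_inner_comm, inner_covOp hT hθ, inner_covOp hT hθ]
  simp only [mul_comm]

theorem covOp_nonneg (hT : Measurable T) {θ : E} (hθ : natParam ν T ∈ 𝓝 θ) (u : E) :
    0 ≤ ⟪u, covOp ν T θ u⟫ := by
  rw [inner_covOp hT hθ]
  exact integral_nonneg fun x => mul_self_nonneg _

theorem memLp_two_stat (hT : Measurable T) {θ : E} (hθ : natParam ν T ∈ 𝓝 θ) :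
    MemLp T 2 (expFamily ν T θ) := by
  rw [memLp_two_iff_integrable_sq_norm hT.aestronglyMeasurable]
  refine ((subexpGrowth_self T).bilin (subexpGrowth_self T) fun x => ?_).integrable_expFamily hT
    (by fun_prop : Measurable fun x => ‖T x‖ ^ 2).aestronglyMeasurable hθ
  rw [norm_pow, norm_norm, sq]

theorem variance_inner_stat (hT : Measurable T) {θ : E} (hθ : natParam ν T ∈ 𝓝 θ) (u : E) :
    Var[fun x => ⟪u, T x⟫; expFamily ν T θ] = ⟪u, covOp ν T θ u⟫ := by
  rw [variance_eq_integral (by fun_prop), integral_inner_stat hT hθ, inner_covOp hT hθ]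
  refine integral_congr_ae (ae_of_all _ fun x => ?_)
  simp only [inner_sub_right]
  ring

/-- Pushing covariance `J` forward by the self-adjoint map `J⁻¹` gives `J⁻¹ J J⁻¹ = J⁻¹`. -/
theorem centeredGaussian_map_symm {J : E ≃L[ℝ] E} (hsym : ∀ u v, ⟪J u, v⟫ = ⟪u, J v⟫)
    {G : Measure E} [IsGaussian G] (h0 : ∫ x, x ∂G = 0)
    (hG : ∀ u v, covarianceBilin G u v = ⟪u, J v⟫) :
    ∫ x, x ∂(G.map (J.symm : E →L[ℝ] E)) = 0 ∧
      ∀ u v, covarianceBilin (G.map (J.symm : E →L[ℝ] E)) u v = ⟪u, J.symm v⟫ := by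
  have hsym' : ∀ u v, ⟪J.symm u, v⟫ = ⟪u, J.symm v⟫ := fun u v => by
    conv_lhs => rw [← J.apply_symm_apply v, ← hsym, J.apply_symm_apply]
  have hadj : ∀ u, (J.symm : E →L[ℝ] E).adjoint u = J.symm u := fun u =>
    ext_inner_left ℝ fun v => by
      rw [ContinuousLinearMap.adjoint_inner_right]
      exact hsym' v u
  constructor
  · rw [integral_map (by fun_prop) (by fun_prop),
      (J.symm : E →L[ℝ] E).integral_comp_comm IsGaussian.integrable_fun_id, h0, map_zero]
  · intro u v
    rw [covarianceBilin_map IsGaussian.memLp_two_id, hG, hadj, hadj, J.apply_symm_apply, hsym']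

theorem tendstoInDistribution_meanParamInv (hT : Measurable T) (hnd : NondegenerateStat ν T)
    (ho : IsOpen (natParam ν T)) {θ : E} (hθ : θ ∈ natParam ν T) {J : E ≃L[ℝ] E}
    (hJ : (J : E →L[ℝ] E) = covOp ν T θ) {G : Measure E} [IsGaussian G] (hG0 : ∫ x, x ∂G = 0)
    (hG : ∀ u v, covarianceBilin G u v = ⟪u, J v⟫) {Z : ℕ → Ω → X}
    (hZ : ∀ i, HasLaw (Z i) (expFamily ν T θ) P) (hindep : iIndepFun Z P) :
    TendstoInDistribution (fun (n : ℕ) ω => √(n : ℝ) •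
        (meanParamInv ν T ((n : ℝ)⁻¹ • ∑ i ∈ Finset.range n, T (Z i ω)) - θ))
      atTop id (fun _ => P) (G.map (J.symm : E →L[ℝ] E)) := by
  have hθ' := ho.mem_nhds hθ
  set Y : ℕ → Ω → E := fun i ω => T (Z i ω)
  have hYm : ∀ i, AEMeasurable (Y i) P := fun i => hT.comp_aemeasurable (hZ i).aemeasurable
  have hident : ∀ i, IdentDistrib (Y i) (Y 0) P P := fun i =>
    (⟨(hZ i).aemeasurable, (hZ 0).aemeasurable, (hZ i).map_eq.trans (hZ 0).map_eq.symm⟩ :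
      IdentDistrib (Z i) (Z 0) P P).comp hT
  have hYi : iIndepFun Y P := hindep.comp (fun _ => T) fun _ => hT
  have hLp : MemLp (Y 0) 2 P := by
    have h := memLp_two_stat (ν := ν) hT hθ'
    rw [← (hZ 0).map_eq] at h
    exact (memLp_map_measure_iff hT.aestronglyMeasurable (hZ 0).aemeasurable).1 h
  have hmean : P[Y 0] = meanParam ν T θ := by
    have h := integral_map (hZ 0).aemeasurable (f := T) hT.aestronglyMeasurable
    rw [(hZ 0).map_eq] at h
    exact h.symm
  have hvar : ∀ u, covarianceBilin G u u = Var[fun ω => ⟪u, Y 0 ω⟫; P] := fun u => by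
    have h := variance_map (X := fun x => ⟪u, T x⟫) (Y := Z 0) (μ := P)
      (by fun_prop) (hZ 0).aemeasurable
    rw [(hZ 0).map_eq, variance_inner_stat hT hθ'] at h
    rw [hG, ← ContinuousLinearEquiv.coe_coe J, hJ, h]
    rfl
  have hclt := tendstoInDistribution_clt hLp hYi hident hG0 hvar
  rw [hmean] at hclt
  have hscale : TendstoInDistribution (fun (n : ℕ) ω => √(n : ℝ) •
      ((n : ℝ)⁻¹ • ∑ i ∈ Finset.range n, Y i ω - meanParam ν T θ)) atTop id (fun _ => P) G := by
    refine hclt.congr (fun n => ae_of_all _ fun ω => ?_) (ae_of_all _ fun _ => rfl)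
    dsimp only
    rcases Nat.eq_zero_or_pos n with rfl | hn
    · simp
    have hn' : (0 : ℝ) < n := by exact_mod_cast hn
    have hs : (√(n : ℝ))⁻¹ = √(n : ℝ) * (n : ℝ)⁻¹ := by
      rw [← div_eq_mul_inv, Real.sqrt_div_self]
    rw [hs, mul_smul, smul_sub, smul_smul _ (n : ℝ), inv_mul_cancel₀ hn'.ne', one_smul]
  have hlim := strong_law_ae Y (hLp.integrable one_le_two)
    (fun i j hij => hYi.indepFun hij) hident
  rw [hmean] at hlim
  have h := tendstoInDistribution_deltaMethod hscale (fun n =>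
    (Finset.aemeasurable_fun_sum _ fun i _ => hYm i).const_smul _) hlim
    (measurable_meanParamInv hT hnd ho)
    (hasStrictFDerivAt_meanParamInv hT hnd ho hθ hJ).hasFDerivAt
  rw [meanParamInv_meanParam hT hnd ho hθ] at h
  -- The delta method gives the limit as the variable `J⁻¹` under `G`; the identity under the
  -- pushforward has the same law.
  refine ⟨h.forall_aemeasurable, aemeasurable_id, ?_⟩
  have ht := h.tendsto
  simp only [Measure.map_id]
  exact ht

end MaximumLikelihood

end AsymptoticNormality

/-! ### The natural parameter space of the Hüsler–Reiss family is Θ. -/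

section HueslerReissBase

variable {d : ℕ}

/-- The exponent `-½ yᵀQy + lᵀy` of the Hüsler-Reiss density in logarithmic coordinates. -/
def hrExponent (θ : HRSpace d) (y : Fin d → ℝ) : ℝ :=
  -(1 / 2) * (y ⬝ᵥ (matPart θ).mulVec y) + vecPart θ ⬝ᵥ y

theorem matPart_symm (θ : HRSpace d) (i j : Fin d) : matPart θ i j = matPart θ j i := θ.2.1 i j

theorem sum_matPart (θ : HRSpace d) (i : Fin d) : ∑ j, matPart θ i j = 0 := θ.2.2 i

theorem dotProduct_matPart_comm (θ : HRSpace d) (x y : Fin d → ℝ) :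
    x ⬝ᵥ (matPart θ).mulVec y = y ⬝ᵥ (matPart θ).mulVec x := by
  rw [Matrix.dotProduct_mulVec, dotProduct_comm]
  congr 1
  ext i
  simp [Matrix.vecMul, Matrix.mulVec, dotProduct, matPart_symm θ i, mul_comm]

theorem matPart_mulVec_const (θ : HRSpace d) (s : ℝ) : (matPart θ).mulVec (fun _ => s) = 0 := by
  ext i
  simp [Matrix.mulVec, dotProduct, ← Finset.sum_mul, sum_matPart]

theorem matPart_mulVec_centered (θ : HRSpace d) (y : Fin d → ℝ) :
    (matPart θ).mulVec (centered y) = (matPart θ).mulVec y := by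
  have : centered y = y - fun _ => (d : ℝ)⁻¹ * ∑ k, y k := rfl
  rw [this, Matrix.mulVec_sub, matPart_mulVec_const, sub_zero]

theorem quadForm_centered (θ : HRSpace d) (y : Fin d → ℝ) :
    centered y ⬝ᵥ (matPart θ).mulVec (centered y) = y ⬝ᵥ (matPart θ).mulVec y := by
  rw [matPart_mulVec_centered, dotProduct_matPart_comm, matPart_mulVec_centered]

/-- Since `Q 1_d = 0`, centering the logarithms does not change the quadratic form. This puts the
statistic in `E` and makes the model an exponential family. -/
theorem inner_suffStat (θ : HRSpace d) (z : Fin d → ℝ) :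
    ⟪θ, suffStat z⟫ = hrExponent θ (logVec z) := by
  rw [hrExponent, ← quadForm_centered, Submodule.coe_inner, PiLp.inner_apply,
    Fintype.sum_sum_type, Fintype.sum_prod_type]
  simp only [suffStat, dotProduct, Matrix.mulVec, matPart, vecPart, Finset.mul_sum,
    Sum.elim_inl, Sum.elim_inr, Matrix.of_apply, RCLike.inner_apply, conj_trivial]
  congr 1
  · refine Finset.sum_congr rfl fun i _ => Finset.sum_congr rfl fun j _ => by ring
  · refine Finset.sum_congr rfl fun i _ => by ring

theorem hrExponent_add (θ : HRSpace d) (x y : Fin d → ℝ) :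
    hrExponent θ (x + y) = hrExponent θ x + hrExponent θ y - y ⬝ᵥ (matPart θ).mulVec x := by
  simp only [hrExponent, Matrix.mulVec_add, dotProduct_add, add_dotProduct]
  rw [dotProduct_matPart_comm θ x y]
  ring

theorem hrExponent_smul (θ : HRSpace d) (t : ℝ) (y : Fin d → ℝ) :
    hrExponent θ (t • y) =
      -(1 / 2) * t ^ 2 * (y ⬝ᵥ (matPart θ).mulVec y) + t * (vecPart θ ⬝ᵥ y) := by
  simp only [hrExponent, Matrix.mulVec_smul, dotProduct_smul, smul_dotProduct, smul_eq_mul]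
  ring

theorem continuous_hrExponent (θ : HRSpace d) : Continuous (hrExponent θ) := by
  unfold hrExponent
  simp only [dotProduct, Matrix.mulVec]
  fun_prop

theorem eq_zero_of_matPart_vecPart {θ : HRSpace d} (h : matPart θ = 0) (h' : vecPart θ = 0) :
    θ = 0 := by
  ext k
  rcases k with ⟨i, j⟩ | k
  · exact congrFun (congrFun h i) j
  · exact congrFun h' k

/-- Semidefiniteness with kernel `span 1_d` amounts to positive definiteness on the vectors of sum
zero, by splitting off the mean. Openness and integrability are proved in this form. -/
theorem mem_hrTheta_iff (hd : d ≠ 0) (θ : HRSpace d) :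
    θ ∈ hrTheta d ↔ (∀ v : Fin d → ℝ, v ≠ 0 → ∑ i, v i = 0 → 0 < v ⬝ᵥ (matPart θ).mulVec v) ∧
      ∑ k, vecPart θ k < 0 := by
  have hd' : (d : ℝ) ≠ 0 := Nat.cast_ne_zero.2 hd
  constructor
  · rintro ⟨hp, hk, hl⟩
    refine ⟨fun v hv hs => ?_, hl⟩
    have h0 := hp.dotProduct_mulVec_nonneg v
    rw [star_trivial] at h0
    refine lt_of_le_of_ne h0 fun he => hv ?_
    have h1 : (matPart θ).mulVec v = 0 := by
      rw [← hp.dotProduct_mulVec_zero_iff v, star_trivial, ← he]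
    have h2 : v ∈ LinearMap.ker (matPart θ).mulVecLin := h1
    rw [hk, Submodule.mem_span_singleton] at h2
    obtain ⟨c, rfl⟩ := h2
    have : c = 0 := by simpa [hd] using hs
    simp [this]
  · rintro ⟨hp, hl⟩
    have hx : ∀ x : Fin d → ℝ, x = centered x + (fun _ => (d : ℝ)⁻¹ * ∑ k, x k) := fun x => by
      ext i; simp [centered]
    refine ⟨Matrix.PosSemidef.of_dotProduct_mulVec_nonneg ?_ fun x => ?_, ?_, hl⟩
    · ext i j
      exact matPart_symm θ j i
    · rw [star_trivial, ← quadForm_centered]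
      by_cases h : centered x = 0
      · simp [h]
      · exact (hp _ h (sum_centered x)).le
    · ext x
      rw [Submodule.mem_span_singleton, LinearMap.mem_ker, Matrix.mulVecLin_apply]
      constructor
      · intro h
        have h0 : centered x = 0 := by
          by_contra hne
          have := hp _ hne (sum_centered x)
          rw [quadForm_centered, h, dotProduct_zero] at this
          exact lt_irrefl _ this
        refine ⟨(d : ℝ)⁻¹ * ∑ k, x k, ?_⟩
        conv_rhs => rw [hx x, h0, zero_add]
        ext i; simp
      · rintro ⟨c, rfl⟩
        rw [Matrix.mulVec_smul, matPart_mulVec_const, smul_zero]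

theorem matPart_combo (a b : ℝ) (θ η : HRSpace d) :
    matPart (a • θ + b • η) = a • matPart θ + b • matPart η := rfl

theorem convex_hrTheta (hd : d ≠ 0) : Convex ℝ (hrTheta d) := by
  intro θ hθ η hη a b ha hb hab
  rw [mem_hrTheta_iff hd] at hθ hη ⊢
  refine ⟨fun v hv hs => ?_, ?_⟩
  · rw [matPart_combo, Matrix.add_mulVec, Matrix.smul_mulVec, Matrix.smul_mulVec,
      dotProduct_add, dotProduct_smul, dotProduct_smul, smul_eq_mul, smul_eq_mul]
    have h1 := hθ.1 v hv hs
    have h2 := hη.1 v hv hs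
    rcases ha.eq_or_lt with rfl | ha
    · have : b = 1 := by linarith
      subst this; linarith
    · nlinarith [mul_pos ha h1, mul_nonneg hb h2.le]
  · have : ∑ k, vecPart (a • θ + b • η) k = a * ∑ k, vecPart θ k + b * ∑ k, vecPart η k := by
      rw [Finset.mul_sum, Finset.mul_sum, ← Finset.sum_add_distrib]
      rfl
    rw [this]
    rcases ha.eq_or_lt with rfl | ha
    · have : b = 1 := by linarith
      subst this; linarith [hη.2]
    · nlinarith [mul_neg_of_pos_of_neg ha hθ.2, mul_nonneg hb (neg_nonneg.2 hη.2.le)]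

/-- The unit sphere of the hyperplane of vectors with coordinate sum `0`. -/
theorem isCompact_centeredSphere :
    IsCompact {v : Fin d → ℝ | ‖v‖ = 1 ∧ ∑ i, v i = 0} := by
  have h : {v : Fin d → ℝ | ‖v‖ = 1 ∧ ∑ i, v i = 0} =
      Metric.sphere 0 1 ∩ {v | ∑ i, v i = 0} := by
    ext v; simp
  rw [h]
  exact (isCompact_sphere _ _).inter_right (isClosed_eq (by fun_prop) continuous_const)

theorem continuous_quadForm :
    Continuous fun p : HRSpace d × (Fin d → ℝ) => p.2 ⬝ᵥ (matPart p.1).mulVec p.2 := by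
  simp only [dotProduct, Matrix.mulVec, matPart, Matrix.of_apply]
  fun_prop

theorem continuous_sum_vecPart : Continuous fun θ : HRSpace d => ∑ k, vecPart θ k := by
  simp only [vecPart]
  fun_prop

theorem quadForm_lower {θ : HRSpace d} {c : ℝ}
    (h : ∀ v : Fin d → ℝ, ‖v‖ = 1 → ∑ i, v i = 0 → c ≤ v ⬝ᵥ (matPart θ).mulVec v)
    (v : Fin d → ℝ) (hs : ∑ i, v i = 0) : c * ‖v‖ ^ 2 ≤ v ⬝ᵥ (matPart θ).mulVec v := by
  rcases eq_or_ne v 0 with rfl | hv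
  · simp
  have hn : 0 < ‖v‖ := norm_pos_iff.2 hv
  have h1 := h (‖v‖⁻¹ • v) (by rw [norm_smul, norm_inv, norm_norm, inv_mul_cancel₀ hn.ne'])
    (by simp [← Finset.mul_sum, hs])
  rw [Matrix.mulVec_smul, dotProduct_smul, smul_dotProduct, smul_eq_mul, smul_eq_mul,
    ← mul_assoc, ← mul_inv, ← sq, inv_mul_eq_div, le_div_iff₀ (by positivity)] at h1
  exact h1

/-- Positivity on the compact unit sphere of the hyperplane persists under small perturbations. -/
theorem isOpen_hrTheta (hd : d ≠ 0) : IsOpen (hrTheta d) := by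
  rw [isOpen_iff_mem_nhds]
  intro θ hθ
  rw [mem_hrTheta_iff hd] at hθ
  have h1 : ∀ᶠ η in 𝓝 θ, ∀ v ∈ {v : Fin d → ℝ | ‖v‖ = 1 ∧ ∑ i, v i = 0},
      0 < v ⬝ᵥ (matPart η).mulVec v := by
    refine isCompact_centeredSphere.eventually_forall_of_forall_eventually fun v hv => ?_
    refine (continuous_quadForm (d := d)).continuousAt.eventually_const_lt ?_
    exact hθ.1 v (by rintro rfl; simp at hv) hv.2
  have h2 : ∀ᶠ η in 𝓝 θ, ∑ k, vecPart η k < 0 :=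
    continuous_sum_vecPart.continuousAt.eventually_lt_const hθ.2
  filter_upwards [h1, h2] with η h1 h2
  rw [mem_hrTheta_iff hd]
  refine ⟨fun v hv hs => ?_, h2⟩
  have hn : 0 < ‖v‖ := norm_pos_iff.2 hv
  have h3 := h1 (‖v‖⁻¹ • v)
    ⟨by rw [norm_smul, norm_inv, norm_norm, inv_mul_cancel₀ hn.ne'], by simp [← Finset.mul_sum, hs]⟩
  rw [Matrix.mulVec_smul, dotProduct_smul, smul_dotProduct, smul_eq_mul, smul_eq_mul] at h3
  exact pos_of_mul_pos_right (pos_of_mul_pos_right h3 (by positivity)) (by positivity)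

theorem exists_quadForm_lower (hd : 2 ≤ d) {θ : HRSpace d} (hθ : θ ∈ hrTheta d) :
    ∃ c > 0, ∀ v : Fin d → ℝ, ∑ i, v i = 0 → c * ‖v‖ ^ 2 ≤ v ⬝ᵥ (matPart θ).mulVec v := by
  rw [mem_hrTheta_iff (by omega)] at hθ
  rcases (Set.eq_empty_or_nonempty {v : Fin d → ℝ | ‖v‖ = 1 ∧ ∑ i, v i = 0}) with he | hne
  · refine ⟨1, one_pos, quadForm_lower fun v hv hs => ?_⟩
    exact absurd (show v ∈ {v : Fin d → ℝ | ‖v‖ = 1 ∧ ∑ i, v i = 0} from ⟨hv, hs⟩) (by simp [he])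
  · obtain ⟨v, hv, hmin⟩ := isCompact_centeredSphere.exists_isMinOn hne
      (f := fun v => v ⬝ᵥ (matPart θ).mulVec v)
      ((continuous_quadForm (d := d)).comp (Continuous.prodMk_right θ)).continuousOn
    exact ⟨_, hθ.1 v (by rintro rfl; simp at hv) hv.2,
      quadForm_lower fun w hw hs => hmin (show w ∈ _ from ⟨hw, hs⟩)⟩

/-- The support of the logarithm of a Hüsler-Reiss Pareto vector. -/
def hrLogRegion (a : Fin d → ℝ) : Set (Fin d → ℝ) := {y | ∃ i, Real.log (a i) < y i}

theorem isOpen_hrLogRegion (a : Fin d → ℝ) : IsOpen (hrLogRegion a) := by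
  have : hrLogRegion a = ⋃ i, {y | Real.log (a i) < y i} := by
    ext y; simp [hrLogRegion]
  rw [this]
  exact isOpen_iUnion fun i => isOpen_lt continuous_const (continuous_apply i)

/-- Write `y = w + s 1_d` with `w` centered. The quadratic part gives decay in `w`, and `l^T 1_d <
0` gives decay as `s → ∞`. On the region some coordinate exceeds `log aᵢ`, so `s` can be very
negative only if `w` is large. -/
theorem hrExponent_le (hd : 2 ≤ d) (a : Fin d → ℝ) {θ : HRSpace d} (hθ : θ ∈ hrTheta d) :
    ∃ C : ℝ, ∃ ε > 0, ∀ y ∈ hrLogRegion a, hrExponent θ y ≤ C - ε * ‖y‖ := by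
  obtain ⟨c, hc, hQ⟩ := exists_quadForm_lower hd hθ
  have hd0 : (d : ℝ) ≠ 0 := by positivity
  set L := -∑ k, vecPart θ k
  have hL : 0 < L := neg_pos.2 hθ.2.2
  set K := ∑ k, |vecPart θ k|
  set A := ∑ k, |Real.log (a k)|
  -- Of the `3 L ‖w‖`, one part comes from `‖y‖ ≤ ‖w‖ + |s|` and two from the bound on `|s|`, which
  -- also gives `2 L A`. Completing the square against `c ‖w‖² / 2` yields the first term.
  refine ⟨(K + 3 * L) ^ 2 / (2 * c) + 2 * L * A, L, hL, fun y hy => ?_⟩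
  set w := centered y
  set s := (d : ℝ)⁻¹ * ∑ k, y k
  have hyw : y = w + fun _ => s := by ext i; simp [w, s, centered]
  have hlw : vecPart θ ⬝ᵥ w ≤ K * ‖w‖ := by
    rw [dotProduct, Finset.sum_mul]
    refine Finset.sum_le_sum fun i _ => ?_
    refine (le_abs_self _).trans ?_
    rw [abs_mul]
    exact mul_le_mul_of_nonneg_left (norm_le_pi_norm w i) (abs_nonneg _)
  have hls : vecPart θ ⬝ᵥ y = vecPart θ ⬝ᵥ w - L * s := by
    conv_lhs => rw [hyw]
    rw [dotProduct_add]
    simp [dotProduct, ← Finset.sum_mul, L]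
  have hs : -A - ‖w‖ ≤ s := by
    obtain ⟨i, hi⟩ := hy
    have h1 : y i = w i + s := congrFun hyw i
    have h2 : w i ≤ ‖w‖ := (le_abs_self _).trans (norm_le_pi_norm w i)
    have h3 : |Real.log (a i)| ≤ A :=
      Finset.single_le_sum (f := fun k => |Real.log (a k)|) (fun _ _ => abs_nonneg _)
        (Finset.mem_univ i)
    linarith [neg_abs_le (Real.log (a i))]
  have hA : 0 ≤ A := Finset.sum_nonneg fun _ _ => abs_nonneg _
  have hns : |s| ≤ s + 2 * A + 2 * ‖w‖ := by
    rcases abs_cases s with ⟨h, _⟩ | ⟨h, _⟩ <;> rw [h] <;> linarith [norm_nonneg w]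
  have hny : ‖y‖ ≤ ‖w‖ + |s| := by
    conv_lhs => rw [hyw]
    refine (norm_add_le _ _).trans (add_le_add le_rfl ?_)
    exact (pi_norm_le_iff_of_nonneg (abs_nonneg s)).2 fun i => le_rfl
  have hq := hQ w (sum_centered y)
  rw [quadForm_centered] at hq
  have hsq : (K + 3 * L) * ‖w‖ ≤ c * ‖w‖ ^ 2 / 2 + (K + 3 * L) ^ 2 / (2 * c) := by
    have h0 : 0 ≤ (c * ‖w‖ - (K + 3 * L)) ^ 2 / (2 * c) := by positivity
    have h1 : (c * ‖w‖ - (K + 3 * L)) ^ 2 / (2 * c) =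
        c * ‖w‖ ^ 2 / 2 + (K + 3 * L) ^ 2 / (2 * c) - (K + 3 * L) * ‖w‖ := by
      field_simp
      ring
    linarith
  rw [hrExponent, hls]
  nlinarith [mul_le_mul_of_nonneg_left hns hL.le, mul_le_mul_of_nonneg_left hny hL.le]

theorem integrableOn_exp_hrExponent (hd : 2 ≤ d) (a : Fin d → ℝ) {θ : HRSpace d}
    (hθ : θ ∈ hrTheta d) : IntegrableOn (fun y => Real.exp (hrExponent θ y)) (hrLogRegion a) := by
  obtain ⟨C, ε, hε, hb⟩ := hrExponent_le hd a hθ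
  have h1 : Integrable (fun y : Fin d → ℝ => (1 + ‖y‖) ^ (-((d + 1 : ℕ) : ℝ))) := by
    refine integrable_one_add_norm ?_
    simp
  refine ((h1.const_mul (Real.exp (C + ε) * ((d + 1).factorial / ε ^ (d + 1)))).integrableOn
    (s := hrLogRegion a)).mono'
    (Real.continuous_exp.comp (continuous_hrExponent θ)).aestronglyMeasurable ?_
  refine (ae_restrict_iff' (isOpen_hrLogRegion a).measurableSet).2 (ae_of_all _ fun y hy => ?_)
  rw [Real.norm_eq_abs, abs_of_pos (Real.exp_pos _), Real.rpow_neg (by positivity),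
    Real.rpow_natCast]
  have hp : 0 < 1 + ‖y‖ := by positivity
  have h2 := Real.pow_div_factorial_le_exp (ε * (1 + ‖y‖)) (by positivity) (d + 1)
  calc Real.exp (hrExponent θ y) ≤ Real.exp (C + ε) * Real.exp (-(ε * (1 + ‖y‖))) := by
        rw [← Real.exp_add, Real.exp_le_exp]
        linarith [hb y hy]
    _ ≤ Real.exp (C + ε) * ((ε * (1 + ‖y‖)) ^ (d + 1) / (d + 1).factorial)⁻¹ := by
        rw [Real.exp_neg]
        exact mul_le_mul_of_nonneg_left (inv_anti₀ (by positivity) h2) (Real.exp_pos _).le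
    _ = _ := by
        rw [mul_pow, inv_div]
        field_simp

/-- The translates of `B` are pairwise disjoint and lie in `U`. Finite mass on `U` is thus refuted
by infinitely many translates on which `f` does not decay. -/
theorem tsum_lintegral_translates_le (f : (Fin d → ℝ) → ENNReal)
    {U B : Set (Fin d → ℝ)} (hB : MeasurableSet B) (w : ℕ → Fin d → ℝ)
    (hw : ∀ k, ∀ y ∈ B, y + w k ∈ U)
    (hdisj : Pairwise fun j k => ∀ y ∈ B, y + w j - w k ∉ B) :
    ∑' k, ∫⁻ y in B, f (y + w k) ≤ ∫⁻ y in U, f y := by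
  have hS : ∀ k, MeasurableSet ((fun y => y - w k) ⁻¹' B) := fun k =>
    (measurable_id.sub_const (w k)) hB
  have h1 : ∀ k, ∫⁻ y in B, f (y + w k) = ∫⁻ y in (fun y => y - w k) ⁻¹' B, f y := by
    intro k
    rw [← lintegral_indicator hB, ← lintegral_indicator (hS k),
      ← lintegral_add_right_eq_self (((fun y => y - w k) ⁻¹' B).indicator f) (w k)]
    refine lintegral_congr fun y => ?_
    by_cases hy : y ∈ B
    · rw [Set.indicator_of_mem hy, Set.indicator_of_mem (by simpa using hy)]
    · rw [Set.indicator_of_notMem hy, Set.indicator_of_notMem (by simpa using hy)]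
  simp_rw [h1]
  rw [← lintegral_iUnion hS]
  · refine lintegral_mono_set (Set.iUnion_subset fun k y hy => ?_)
    simpa using hw k _ hy
  · intro j k hjk
    refine Set.disjoint_left.2 fun y hy hy' => hdisj hjk _ hy ?_
    simpa using hy'

theorem ball_translates_disjoint {c v : Fin d → ℝ} (hv : 1 ≤ ‖v‖) {j k : ℤ} (hjk : j ≠ k)
    {y : Fin d → ℝ} (hy : y ∈ Metric.ball c (1 / 2)) :
    y + (j : ℝ) • v - (k : ℝ) • v ∉ Metric.ball c (1 / 2) := by
  intro h
  have h1 := dist_triangle_right (y + (j : ℝ) • v - (k : ℝ) • v) y c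
  rw [dist_eq_norm, add_sub_assoc, add_sub_cancel_left, ← sub_smul, norm_smul] at h1
  have h2 : (1 : ℝ) ≤ ‖(j : ℝ) - k‖ := by
    rw [Real.norm_eq_abs]
    exact_mod_cast Int.one_le_abs (sub_ne_zero.2 hjk)
  rw [Metric.mem_ball] at hy h
  rw [add_sub_assoc, ← sub_smul] at h
  nlinarith

theorem tsum_const_setLIntegral_eq_top {f : (Fin d → ℝ) → ENNReal} (hf : Measurable f)
    (hpos : ∀ y, f y ≠ 0) (c : Fin d → ℝ) :
    ∑' _ : ℕ, ∫⁻ y in Metric.ball c (1 / 2), f y = ⊤ := by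
  refine ENNReal.tsum_const_eq_top_of_ne_zero fun h => ?_
  rw [lintegral_eq_zero_iff hf, Filter.EventuallyEq, ae_restrict_iff' measurableSet_ball] at h
  have h2 : ∀ᵐ y : Fin d → ℝ, y ∉ Metric.ball c (1 / 2) := by
    filter_upwards [h] with y hy hyB using hpos y (hy hyB)
  have h3 : volume (Metric.ball c (1 / 2)) = 0 := by
    rw [ae_iff] at h2
    simpa only [not_not] using! h2
  exact (Metric.measure_ball_pos volume c (by norm_num)).ne' h3

/-- When a condition defining Θ fails, there is a direction along which the density does not decay,
at least after symmetrization, and infinitely many disjoint balls contribute too much mass. -/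
theorem mem_hrTheta_of_integrableOn (hd : 2 ≤ d) (a : Fin d → ℝ) {θ : HRSpace d}
    (hθ : IntegrableOn (fun y => Real.exp (hrExponent θ y)) (hrLogRegion a)) :
    θ ∈ hrTheta d := by
  have : Nonempty (Fin d) := ⟨⟨0, by omega⟩⟩
  set f : (Fin d → ℝ) → ENNReal := fun y => ENNReal.ofReal (Real.exp (hrExponent θ y))
  have hf : Measurable f := by
    have := (continuous_hrExponent θ).measurable
    fun_prop
  have hfpos : ∀ y, f y ≠ 0 := fun y => (ENNReal.ofReal_pos.2 (Real.exp_pos _)).ne'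
  have hfin : ∫⁻ y in hrLogRegion a, f y ≠ ⊤ := by
    have := hθ.2
    rw [hasFiniteIntegral_iff_ofReal (ae_of_all _ fun y => (Real.exp_pos _).le)] at this
    exact this.ne
  -- In the ball of radius 1/2 about `c` every coordinate exceeds `log aᵢ`, so a translate stays in
  -- the region as soon as one coordinate of the shift is nonnegative.
  set c : Fin d → ℝ := fun i => Real.log (a i) + 1
  set B := Metric.ball c (1 / 2)
  have hB : ∀ y ∈ B, ∀ i, Real.log (a i) < y i := by
    intro y hy i
    have h1 : |y i - c i| < 1 / 2 := (dist_pi_lt_iff (by norm_num)).1 hy i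
    have h2 := (abs_lt.1 h1).1
    simp only [c] at h2
    linarith
  rw [mem_hrTheta_iff (by omega)]
  constructor
  · intro v hv hs
    by_contra hq
    push Not at hq
    have hn : 0 < ‖v‖ := norm_pos_iff.2 hv
    set u := ‖v‖⁻¹ • v
    have hu : 1 ≤ ‖u‖ := by
      rw [norm_smul, norm_inv, norm_norm, inv_mul_cancel₀ hn.ne']
    have hus : ∑ i, u i = 0 := by simp [u, ← Finset.mul_sum, hs]
    have huq : u ⬝ᵥ (matPart θ).mulVec u ≤ 0 := by
      rw [Matrix.mulVec_smul, dotProduct_smul, smul_dotProduct, smul_eq_mul, smul_eq_mul]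
      exact mul_nonpos_of_nonneg_of_nonpos (by positivity)
        (mul_nonpos_of_nonneg_of_nonpos (by positivity) hq)
    clear_value u
    -- As `u` has sum zero, it has a coordinate `≥ 0` and a coordinate `≤ 0`, so shifts along both
    -- `u` and `-u` are allowed.
    obtain ⟨i, -, hi⟩ := Finset.exists_le_of_sum_le (s := Finset.univ) (f := fun _ => (0 : ℝ))
      (g := u) Finset.univ_nonempty (by simp [hus])
    obtain ⟨j, -, hj⟩ := Finset.exists_le_of_sum_le (s := Finset.univ) (f := u)
      (g := fun _ => (0 : ℝ)) Finset.univ_nonempty (by simp [hus])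
    have h1 := tsum_lintegral_translates_le f (U := hrLogRegion a) (B := B) measurableSet_ball
      (fun k => (k : ℝ) • u)
      (fun k y hy => ⟨i, by
        have := hB y hy i
        have : 0 ≤ (k : ℝ) * u i := mul_nonneg (Nat.cast_nonneg _) hi
        simp only [Pi.add_apply, Pi.smul_apply, smul_eq_mul]; linarith⟩)
      (fun j k hjk y hy => by
        have h := ball_translates_disjoint hu (j := j) (k := k) (by exact_mod_cast hjk) hy
        simp only [Int.cast_natCast] at h
        exact h)
    have h2 := tsum_lintegral_translates_le f (U := hrLogRegion a) (B := B) measurableSet_ball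
      (fun k => -((k : ℝ) • u))
      (fun k y hy => ⟨j, by
        have := hB y hy j
        have : (k : ℝ) * u j ≤ 0 := mul_nonpos_of_nonneg_of_nonpos (Nat.cast_nonneg _) hj
        simp only [Pi.add_apply, Pi.neg_apply, Pi.smul_apply, smul_eq_mul]; linarith⟩)
      (fun j k hjk y hy => by
        have h := ball_translates_disjoint hu (j := -j) (k := -k) (by simpa using hjk) hy
        simp only [Int.cast_neg, Int.cast_natCast, neg_smul] at h
        exact h)
    -- The terms linear in `k` cancel between `y + k u` and `y - k u`, and the quadratic term is not
    -- negative, so one of the two exponents is at least the exponent at `y`.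
    have h3 : ∑' _ : ℕ, ∫⁻ y in B, f y ≤
        (∑' k : ℕ, ∫⁻ y in B, f (y + (k : ℝ) • u)) + ∑' k : ℕ, ∫⁻ y in B, f (y + -((k : ℝ) • u)) := by
      rw [← ENNReal.tsum_add]
      refine ENNReal.tsum_le_tsum fun k => ?_
      rw [← lintegral_add_left (by fun_prop)]
      refine lintegral_mono fun y => ?_
      have e1 := hrExponent_add θ y ((k : ℝ) • u)
      have e2 := hrExponent_add θ y ((-(k : ℝ)) • u)
      rw [hrExponent_smul, smul_dotProduct, smul_eq_mul] at e1 e2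
      rw [neg_smul] at e2
      have e3 : (k : ℝ) ^ 2 * (u ⬝ᵥ (matPart θ).mulVec u) ≤ 0 :=
        mul_nonpos_of_nonneg_of_nonpos (by positivity) huq
      rcases le_total (hrExponent θ y) (hrExponent θ (y + (k : ℝ) • u)) with h | h
      · exact (ENNReal.ofReal_le_ofReal (Real.exp_le_exp.2 h)).trans le_self_add
      · refine (ENNReal.ofReal_le_ofReal (Real.exp_le_exp.2 ?_)).trans le_add_self
        linarith
    rw [tsum_const_setLIntegral_eq_top hf hfpos c, top_le_iff, ENNReal.add_eq_top] at h3
    rcases h3 with h3 | h3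
    · exact hfin (top_le_iff.1 (h3 ▸ h1))
    · exact hfin (top_le_iff.1 (h3 ▸ h2))
  -- Along `1_d` the quadratic form is blind and the exponent changes by `k l^T 1_d ≥ 0`.
  · by_contra hl
    push Not at hl
    have h1 := tsum_lintegral_translates_le f (U := hrLogRegion a) (B := B) measurableSet_ball
      (fun k => (k : ℝ) • fun _ => (1 : ℝ))
      (fun k y hy => ⟨⟨0, by omega⟩, by
        have := hB y hy ⟨0, by omega⟩
        have : (0 : ℝ) ≤ k := Nat.cast_nonneg _
        simp only [Pi.add_apply, Pi.smul_apply, smul_eq_mul]; linarith⟩)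
      (fun j k hjk y hy => by
        have h := ball_translates_disjoint (v := fun _ => (1 : ℝ)) (by simp) (j := j) (k := k)
          (by exact_mod_cast hjk) hy
        simp only [Int.cast_natCast] at h
        exact h)
    have h3 : ∑' _ : ℕ, ∫⁻ y in B, f y ≤
        ∑' k : ℕ, ∫⁻ y in B, f (y + (k : ℝ) • fun _ => (1 : ℝ)) := by
      refine ENNReal.tsum_le_tsum fun k => lintegral_mono fun y => ?_
      refine ENNReal.ofReal_le_ofReal (Real.exp_le_exp.2 ?_)
      rw [hrExponent_add, hrExponent_smul,
        dotProduct_matPart_comm θ ((k : ℝ) • fun _ => (1 : ℝ)) y, Matrix.mulVec_smul,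
        matPart_mulVec_const, smul_zero, dotProduct_zero, dotProduct_zero]
      have h4 : vecPart θ ⬝ᵥ (fun _ => (1 : ℝ)) = ∑ k, vecPart θ k := by simp [dotProduct]
      rw [h4]
      nlinarith [mul_nonneg (Nat.cast_nonneg k : (0 : ℝ) ≤ k) hl]
    rw [tsum_const_setLIntegral_eq_top hf hfpos c] at h3
    exact hfin (top_le_iff.1 (h3.trans h1))

/-- The base measure `∏ zᵢ⁻¹ dz` on the support, for which the Hüsler-Reiss Pareto distributions
form an exponential family. -/
def hrBase (a : Fin d → ℝ) : Measure (Fin d → ℝ) :=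
  (volume.restrict (hrRegion a)).withDensity fun z => ENNReal.ofReal (∏ i, (z i)⁻¹)

theorem measurable_logVec : Measurable (logVec : (Fin d → ℝ) → Fin d → ℝ) := by
  unfold logVec
  fun_prop

theorem logVec_exp (y : Fin d → ℝ) : logVec (fun i => Real.exp (y i)) = y := by
  ext i; simp [logVec]

theorem mem_hrRegion_iff {a : Fin d → ℝ} (ha : ∀ i, 0 < a i) (z : Fin d → ℝ) :
    z ∈ hrRegion a ↔ (∀ i, 0 < z i) ∧ logVec z ∈ hrLogRegion a := by
  simp only [hrRegion, Set.mem_ofPred_eq, Pi.le_def, not_forall, not_le, hrLogRegion, logVec]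
  refine and_congr_right fun hz => exists_congr fun i => ?_
  exact (Real.log_lt_log_iff (ha i) (hz i)).symm

theorem isOpen_hrRegion (a : Fin d → ℝ) : IsOpen (hrRegion a) := by
  have : hrRegion a = (⋂ i, {z | 0 < z i}) ∩ ⋃ i, {z | a i < z i} := by
    ext z; simp [hrRegion, Pi.le_def]
  rw [this]
  exact (isOpen_iInter_of_finite fun i => isOpen_lt continuous_const (continuous_apply i)).inter
    (isOpen_iUnion fun i => isOpen_lt continuous_const (continuous_apply i))

theorem hasFDerivAt_expVec (y : Fin d → ℝ) :
    HasFDerivAt (fun (y : Fin d → ℝ) i => Real.exp (y i))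
      (LinearMap.toContinuousLinearMap
        (Matrix.toLin' (Matrix.diagonal fun i => Real.exp (y i)))) y := by
  rw [hasFDerivAt_pi']
  intro i
  have h : HasFDerivAt (fun y : Fin d → ℝ => y i) (ContinuousLinearMap.proj i) y :=
    (ContinuousLinearMap.proj (R := ℝ) (φ := fun _ : Fin d => ℝ) i).hasFDerivAt
  refine h.exp.congr_fderiv ?_
  ext v
  simp [Matrix.mulVec_diagonal]

/-- In logarithmic coordinates the base measure is Lebesgue measure. -/
theorem map_logVec_hrBase {a : Fin d → ℝ} (ha : ∀ i, 0 < a i) :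
    (hrBase a).map logVec = volume.restrict (hrLogRegion a) := by
  ext s hs
  have hls : MeasurableSet (logVec ⁻¹' s) := measurable_logVec hs
  have hU := (isOpen_hrLogRegion a).measurableSet
  have himage : (fun (y : Fin d → ℝ) i => Real.exp (y i)) '' (s ∩ hrLogRegion a) =
      logVec ⁻¹' s ∩ hrRegion a := by
    ext z
    rw [Set.mem_inter_iff, mem_hrRegion_iff ha]
    constructor
    · rintro ⟨y, ⟨hy, hy'⟩, rfl⟩
      refine ⟨?_, fun i => Real.exp_pos _, ?_⟩
      · rw [Set.mem_preimage, logVec_exp]; exact hy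
      · rw [logVec_exp]; exact hy'
    · rintro ⟨h1, h2, h3⟩
      exact ⟨logVec z, ⟨h1, h3⟩, by ext i; simp [logVec, Real.exp_log (h2 i)]⟩
  rw [Measure.map_apply measurable_logVec hs, hrBase, withDensity_apply _ hls,
    Measure.restrict_restrict hls, ← himage,
    lintegral_image_eq_lintegral_abs_det_fderiv_mul volume (hs.inter hU)
      (fun y _ => (hasFDerivAt_expVec y).hasFDerivWithinAt)
      (fun x _ y _ h => by
        ext i; exact Real.exp_injective (congrFun h i)),
    Measure.restrict_apply hs]
  rw [← setLIntegral_one]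
  refine lintegral_congr fun y => ?_
  rw [LinearMap.det_toContinuousLinearMap, LinearMap.det_toLin', Matrix.det_diagonal,
    ← ENNReal.ofReal_mul (abs_nonneg _), abs_of_pos (Finset.prod_pos fun i _ => Real.exp_pos _),
    Finset.prod_inv_distrib, mul_inv_cancel₀ (Finset.prod_pos fun i _ => Real.exp_pos _).ne',
    ENNReal.ofReal_one]

theorem natParam_hrBase (hd : 2 ≤ d) {a : Fin d → ℝ} (ha : ∀ i, 0 < a i) :
    natParam (hrBase a) suffStat = hrTheta d := by
  ext θ
  have h : θ ∈ natParam (hrBase a) suffStat ↔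
      IntegrableOn (fun y => Real.exp (hrExponent θ y)) (hrLogRegion a) := by
    have h1 := integrable_map_measure (μ := hrBase a) (f := logVec)
      (g := fun y => Real.exp (hrExponent θ y)) (Real.continuous_exp.comp
        (continuous_hrExponent θ)).aestronglyMeasurable measurable_logVec.aemeasurable
    rw [IntegrableOn, ← map_logVec_hrBase ha, h1]
    simp only [natParam, Set.mem_ofPred_eq, inner_suffStat]
    rfl
  rw [h]
  exact ⟨mem_hrTheta_of_integrableOn hd a, integrableOn_exp_hrExponent hd a⟩

end HueslerReissBase

/-! ### Nondegeneracy of the statistic and the role of the sample covariance. -/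

section HueslerReissSample

variable {d : ℕ}

theorem measurable_suffStat : Measurable (suffStat : (Fin d → ℝ) → HRSpace d) := by
  refine Measurable.subtype_mk ?_
  refine (WithLp.measurable_toLp 2 _).comp (measurable_pi_iff.2 ?_)
  rintro (⟨i, j⟩ | k)
  · simp only [Sum.elim_inl, centered, logVec]
    fun_prop
  · simp only [Sum.elim_inr, logVec]
    fun_prop

theorem hrKernel_eq (θ : HRSpace d) (z : Fin d → ℝ) :
    hrKernel θ z = Real.exp ⟪θ, suffStat z⟫ * ∏ i, (z i)⁻¹ := by
  rw [inner_suffStat, hrExponent, hrKernel]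

theorem prod_inv_pos {a z : Fin d → ℝ} (hz : z ∈ hrRegion a) : 0 < ∏ i, (z i)⁻¹ :=
  Finset.prod_pos fun i _ => inv_pos.2 (hz.1 i)

theorem measurable_prod_inv : Measurable fun z : Fin d → ℝ => ∏ i, (z i)⁻¹ := by
  fun_prop

theorem hrC_eq (a : Fin d → ℝ) (θ : HRSpace d) :
    hrC a θ = ∫ z, Real.exp ⟪θ, suffStat z⟫ ∂(hrBase a) := by
  have h1 : hrBase a = (volume.restrict (hrRegion a)).withDensity fun z =>
      ((Real.toNNReal (∏ i, (z i)⁻¹) : NNReal) : ENNReal) := rfl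
  rw [h1, integral_withDensity_eq_integral_smul measurable_prod_inv.real_toNNReal, hrC]
  refine setIntegral_congr_fun (isOpen_hrRegion a).measurableSet fun z hz => ?_
  rw [NNReal.smul_def, Real.coe_toNNReal _ (prod_inv_pos hz).le, hrKernel_eq, smul_eq_mul,
    mul_comm]

theorem hrLogC_eq (a : Fin d → ℝ) : hrLogC a = logPartition (hrBase a) suffStat := by
  funext θ
  rw [hrLogC, hrC_eq, logPartition]

theorem hrPareto_eq (a : Fin d → ℝ) (θ : HRSpace d) :
    hrPareto a θ = expFamily (hrBase a) suffStat θ := by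
  have hR := (isOpen_hrRegion a).measurableSet
  have hT := measurable_suffStat (d := d)
  rw [expFamily, Measure.tilted, hrBase, ← withDensity_mul _
    measurable_prod_inv.ennreal_ofReal (by fun_prop), ← withDensity_indicator hR, hrPareto]
  congr 1
  funext z
  have := hrC_eq a θ
  rw [hrBase] at this
  rw [← this, hrDensity]
  by_cases hz : z ∈ hrRegion a
  · rw [Set.indicator_of_mem hz, Set.indicator_of_mem hz, Pi.mul_apply,
      ← ENNReal.ofReal_mul (prod_inv_pos hz).le, hrKernel_eq]
    congr 1
    ring
  · rw [Set.indicator_of_notMem hz, Set.indicator_of_notMem hz, ENNReal.ofReal_zero]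

theorem ae_hrBase_mem (a : Fin d → ℝ) : ∀ᵐ z ∂(hrBase a), z ∈ hrRegion a :=
  (withDensity_absolutelyContinuous _ _).ae_le (ae_restrict_mem (isOpen_hrRegion a).measurableSet)

theorem continuousOn_inner_suffStat (a : Fin d → ℝ) (u : HRSpace d) :
    ContinuousOn (fun z => ⟪u, suffStat z⟫) (hrRegion a) := by
  simp only [inner_suffStat]
  refine (continuous_hrExponent u).comp_continuousOn (continuousOn_pi.2 fun i => ?_)
  exact (continuous_apply i).continuousOn.log fun z hz => (hz.1 i).ne'

/-- The base measure charges every nonempty open subset of the region, where the statistic is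
continuous. Almost-everywhere statements thus become pointwise ones. -/
theorem hrBase_pos_of_mem (a : Fin d → ℝ) (u : HRSpace d) {O : Set ℝ} (hO : IsOpen O)
    {z : Fin d → ℝ} (hz : z ∈ hrRegion a) (hzO : ⟪u, suffStat z⟫ ∈ O) :
    0 < hrBase a {z | ⟪u, suffStat z⟫ ∈ O} := by
  have hT := measurable_suffStat (d := d)
  have hS : MeasurableSet {z : Fin d → ℝ | ⟪u, suffStat z⟫ ∈ O} :=
    (by fun_prop : Measurable fun z : Fin d → ℝ => ⟪u, suffStat z⟫) hO.measurableSet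
  refine pos_iff_ne_zero.2 fun h => ?_
  have hR := (isOpen_hrRegion a).measurableSet
  have hopen : IsOpen (hrRegion a ∩ {z | ⟪u, suffStat z⟫ ∈ O}) :=
    (continuousOn_inner_suffStat a u).isOpen_inter_preimage (isOpen_hrRegion a) hO
  refine (hopen.measure_pos volume ⟨z, hz, hzO⟩).ne' ?_
  have h1 : ∀ᵐ z ∂(hrBase a), z ∉ {z | ⟪u, suffStat z⟫ ∈ O} := by
    rw [ae_iff]; simpa only [not_not] using! h
  rw [hrBase, ae_withDensity_iff measurable_prod_inv.ennreal_ofReal, ae_restrict_iff' hR] at h1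
  rw [← compl_compl (hrRegion a ∩ _)]
  change _ᶜ ∈ ae _
  filter_upwards [h1] with z hz hz2
  exact hz hz2.1 (ENNReal.ofReal_pos.2 (prod_inv_pos hz2.1)).ne' hz2.2

theorem exists_mem_hrRegion [NeZero d] {a : Fin d → ℝ} (ha : ∀ i, 0 < a i) {y : Fin d → ℝ}
    (hy : y ∈ hrLogRegion a) : ∃ z ∈ hrRegion a, logVec z = y :=
  ⟨fun i => Real.exp (y i), (mem_hrRegion_iff ha _).2
    ⟨fun _ => Real.exp_pos _, by rwa [logVec_exp]⟩, logVec_exp y⟩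

theorem succ_mem_hrLogRegion [NeZero d] (a : Fin d → ℝ) :
    (fun i => Real.log (a i) + 1) ∈ hrLogRegion a := ⟨0, by simp⟩

theorem neZero_hrBase [NeZero d] {a : Fin d → ℝ} (ha : ∀ i, 0 < a i) : NeZero (hrBase a) := by
  obtain ⟨z, hz, -⟩ := exists_mem_hrRegion ha (succ_mem_hrLogRegion a)
  refine ⟨fun h => ?_⟩
  have := hrBase_pos_of_mem a 0 isOpen_univ hz (Set.mem_univ _)
  rw [h] at this
  simp at this

/-- At an interior maximum of the exponent its gradient vanishes. -/
theorem mulVec_eq_of_isMax (u : HRSpace d) {a y : Fin d → ℝ} (hy : y ∈ hrLogRegion a)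
    (hmax : ∀ x ∈ hrLogRegion a, hrExponent u x ≤ hrExponent u y) :
    (matPart u).mulVec y = vecPart u := by
  ext i
  set e : Fin d → ℝ := Pi.single i 1
  set α := -(1 / 2) * (e ⬝ᵥ (matPart u).mulVec e)
  set β := vecPart u ⬝ᵥ e - e ⬝ᵥ (matPart u).mulVec y
  have hform : ∀ t : ℝ, hrExponent u (y + t • e) = hrExponent u y + (α * t ^ 2 + β * t) := by
    intro t
    rw [hrExponent_add, hrExponent_smul, smul_dotProduct, smul_eq_mul]
    simp only [α, β]
    ring
  have hcont : Continuous fun t : ℝ => y + t • e := by fun_prop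
  have hmem : ∀ᶠ t : ℝ in 𝓝 0, y + t • e ∈ hrLogRegion a :=
    hcont.continuousAt.eventually_mem ((isOpen_hrLogRegion a).mem_nhds (by simpa using hy))
  have hloc : IsLocalMax (fun t : ℝ => α * t ^ 2 + β * t) 0 := by
    filter_upwards [hmem] with t ht
    have := hmax _ ht
    rw [hform] at this
    simpa using this
  have hder : HasDerivAt (fun t : ℝ => α * t ^ 2 + β * t) β 0 := by
    have h := ((hasDerivAt_pow 2 (0 : ℝ)).const_mul α).add ((hasDerivAt_id (0 : ℝ)).const_mul β)
    simpa using! h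
  have h0 := hloc.hasDerivAt_eq_zero hder
  simp only [β, e, dotProduct_single_one, single_one_dotProduct] at h0
  linarith

theorem matPart_eq_zero_of_mulVec_single {u : HRSpace d}
    (h : ∀ j, (matPart u).mulVec (Pi.single j 1) = 0) : matPart u = 0 := by
  ext i j
  have := congrFun (h j) i
  simpa using this

/-- If the polynomial of `u = (A, b)` is constant on the region, every point is critical, so `A y =
b` throughout. Comparing `y0` with `y0 + e_j` gives `A e_j = 0`, and then `b = 0`. -/
theorem nondegenerateStat_suffStat [NeZero d] {a : Fin d → ℝ} (ha : ∀ i, 0 < a i) :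
    NondegenerateStat (hrBase a) suffStat := by
  intro u hu c hc
  have hconst : ∀ y ∈ hrLogRegion a, hrExponent u y = c := by
    intro y hy
    by_contra hne
    obtain ⟨z, hz, rfl⟩ := exists_mem_hrRegion ha hy
    have := hrBase_pos_of_mem a u (O := {c}ᶜ) isOpen_compl_singleton hz (by
      rw [inner_suffStat]; exact hne)
    rw [ae_iff] at hc
    exact this.ne' hc
  have hcrit : ∀ y ∈ hrLogRegion a, (matPart u).mulVec y = vecPart u := fun y hy =>
    mulVec_eq_of_isMax u hy fun x hx => (hconst x hx).trans (hconst y hy).symm |>.le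
  set y0 : Fin d → ℝ := fun i => Real.log (a i) + 1
  have h0 : y0 ∈ hrLogRegion a := succ_mem_hrLogRegion a
  have hA : matPart u = 0 := matPart_eq_zero_of_mulVec_single fun j => by
    have h1 : y0 + Pi.single j 1 ∈ hrLogRegion a := ⟨j, by simp [y0]; linarith⟩
    have h2 := hcrit _ h1
    rw [Matrix.mulVec_add, hcrit _ h0] at h2
    simpa using h2
  refine hu (eq_zero_of_matPart_vecPart hA ?_)
  rw [← hcrit _ h0, hA, Matrix.zero_mulVec]

section Sample

variable {n : ℕ}

theorem inner_meanSuffStat (u : HRSpace d) (z : Fin n → Fin d → ℝ) :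
    ⟪u, meanSuffStat z⟫ = (1 / (n : ℝ)) * ∑ i, hrExponent u (logVec (z i)) := by
  have h : ⟪u, meanSuffStat z⟫ = (1 / (n : ℝ)) * ⟪u, ∑ i, suffStat (z i)⟫ :=
    real_inner_smul_right (F := HRSpace d) u (∑ i, suffStat (z i)) (1 / (n : ℝ))
  rw [h, inner_sum]
  simp only [inner_suffStat]

theorem logCov_quadForm (z : Fin n → Fin d → ℝ) (v : Fin d → ℝ) :
    v ⬝ᵥ (logCov z).mulVec v = (1 / (n : ℝ)) * ∑ i, (v ⬝ᵥ logVec (z i)) ^ 2 -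
      ((1 / (n : ℝ)) * ∑ i, v ⬝ᵥ logVec (z i)) ^ 2 := by
  have h : ∀ x : Fin d → ℝ, v ⬝ᵥ (Matrix.vecMulVec x x).mulVec v = (v ⬝ᵥ x) ^ 2 := by
    intro x
    rw [Matrix.vecMulVec_mulVec, dotProduct_comm x v]
    simp [sq]
  rw [logCov, Matrix.sub_mulVec, dotProduct_sub, h, Matrix.smul_mulVec, dotProduct_smul,
    Matrix.sum_mulVec, dotProduct_sum, dotProduct_smul, dotProduct_sum]
  simp only [h, smul_eq_mul]

theorem logCov_quadForm_of_const (hn : n ≠ 0) {z : Fin n → Fin d → ℝ} {v : Fin d → ℝ} {c : ℝ}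
    (h : ∀ i, v ⬝ᵥ logVec (z i) = c) : v ⬝ᵥ (logCov z).mulVec v = 0 := by
  have hn' : (n : ℝ) ≠ 0 := Nat.cast_ne_zero.2 hn
  rw [logCov_quadForm]
  simp [h, hn']

theorem const_of_logCov_quadForm (hn : n ≠ 0) {z : Fin n → Fin d → ℝ} {v : Fin d → ℝ}
    (h : v ⬝ᵥ (logCov z).mulVec v ≤ 0) : ∃ c, ∀ i, v ⬝ᵥ logVec (z i) = c := by
  have hn' : (0 : ℝ) < n := by positivity
  set x : Fin n → ℝ := fun i => v ⬝ᵥ logVec (z i)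
  set m := (1 / (n : ℝ)) * ∑ i, x i
  have hm : ∑ i, x i = n * m := by simp only [m]; field_simp
  have h1 : ∑ i, (x i - m) ^ 2 = n * (v ⬝ᵥ (logCov z).mulVec v) := by
    rw [logCov_quadForm]
    have : ∀ i, (x i - m) ^ 2 = x i ^ 2 - 2 * m * x i + m ^ 2 := fun i => by ring
    simp_rw [this, Finset.sum_add_distrib, Finset.sum_sub_distrib, ← Finset.mul_sum, hm]
    change _ = n * ((1 / (n : ℝ)) * ∑ i, x i ^ 2 - m ^ 2)
    simp
    field_simp
    ring
  have h2 : ∑ i, (x i - m) ^ 2 = 0 :=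
    le_antisymm (h1 ▸ mul_nonpos_of_nonneg_of_nonpos hn'.le h)
      (Finset.sum_nonneg fun _ _ => sq_nonneg _)
  refine ⟨m, fun i => ?_⟩
  have := (Finset.sum_eq_zero_iff_of_nonneg fun _ _ => sq_nonneg _).1 h2 i (Finset.mem_univ i)
  exact sub_eq_zero.1 (pow_eq_zero_iff two_ne_zero |>.1 this)

/-- The sample mean of the polynomial of `u` is `m`. If `m` were an upper bound on the region, every
observation would be an interior maximum, and this is excluded by `V_n`. -/
theorem hrBase_pos_of_condPosDef [NeZero d] (hn : n ≠ 0) {a : Fin d → ℝ} (ha : ∀ i, 0 < a i)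
    {z : Fin n → Fin d → ℝ} (hz : ∀ i, z i ∈ hrRegion a) (hV : CondPosDef (logCov z))
    {u : HRSpace d} (hu : u ≠ 0) :
    0 < hrBase a {x | 0 < ⟪u, suffStat x - meanSuffStat z⟫} := by
  have hn' : (0 : ℝ) < n := by positivity
  set y : Fin n → Fin d → ℝ := fun i => logVec (z i)
  have hy : ∀ i, y i ∈ hrLogRegion a := fun i => ((mem_hrRegion_iff ha _).1 (hz i)).2
  set m := ⟪u, meanSuffStat z⟫
  have hm : ∑ i, (m - hrExponent u (y i)) = 0 := by
    rw [Finset.sum_sub_distrib]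
    simp only [m, inner_meanSuffStat, y]
    simp
    field_simp
    ring
  have key : ∃ x ∈ hrLogRegion a, m < hrExponent u x := by
    by_contra! hle
    have heq : ∀ i, hrExponent u (y i) = m := fun i => by
      have := (Finset.sum_eq_zero_iff_of_nonneg fun i _ => sub_nonneg.2 (hle _ (hy i))).1 hm i
        (Finset.mem_univ i)
      linarith
    have hcrit : ∀ i, (matPart u).mulVec (y i) = vecPart u := fun i =>
      mulVec_eq_of_isMax u (hy i) fun x hx => (hle x hx).trans (heq i).ge
    have hA : matPart u = 0 := by
      ext i j
      have hrow : ∑ k, matPart u i k = 0 := sum_matPart u i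
      by_contra hne
      -- The row `i` has sum zero, and criticality gives it the constant product `bᵢ` with all
      -- log-observations, hence zero sample variance.
      have h1 := hV (matPart u i) (fun h => hne (congrFun h j)) hrow
      rw [logCov_quadForm_of_const hn (c := vecPart u i) fun k => congrFun (hcrit k) i] at h1
      exact lt_irrefl _ h1
    refine hu (eq_zero_of_matPart_vecPart hA ?_)
    rw [← hcrit ⟨0, Nat.pos_of_ne_zero hn⟩, hA, Matrix.zero_mulVec]
  obtain ⟨x, hx, hmx⟩ := key
  obtain ⟨w, hw, rfl⟩ := exists_mem_hrRegion ha hx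
  have h := hrBase_pos_of_mem a u (O := Set.Ioi m) isOpen_Ioi hw (by
    rw [inner_suffStat]; exact hmx)
  have hset : {x | 0 < ⟪u, suffStat x - meanSuffStat z⟫} = {x | ⟪u, suffStat x⟫ ∈ Set.Ioi m} := by
    ext x
    change 0 < ⟪u, suffStat x - meanSuffStat z⟫ ↔ m < ⟪u, suffStat x⟫
    rw [inner_sub_right, sub_pos]
  rwa [hset]

/-- The point `(vvᵀ, cv)` of the parameter space, for `v` with coordinate sum `0`. -/
def rankOneParam (v : Fin d → ℝ) (hv : ∑ i, v i = 0) (c : ℝ) : HRSpace d :=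
  ⟨WithLp.toLp 2 (Sum.elim (fun p => v p.1 * v p.2) fun k => c * v k), by
    refine ⟨fun i j => ?_, fun i => ?_⟩
    · simp [mul_comm]
    · simp [← Finset.mul_sum, hv]⟩

theorem hrExponent_rankOneParam (v : Fin d → ℝ) (hv : ∑ i, v i = 0) (c : ℝ) (y : Fin d → ℝ) :
    hrExponent (rankOneParam v hv c) y = c ^ 2 / 2 - (v ⬝ᵥ y - c) ^ 2 / 2 := by
  have h1 : matPart (rankOneParam v hv c) = Matrix.vecMulVec v v := rfl
  have h2 : vecPart (rankOneParam v hv c) = c • v := rfl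
  rw [hrExponent, h1, h2, Matrix.vecMulVec_mulVec, smul_dotProduct, smul_eq_mul]
  simp only [dotProduct_smul, op_smul_eq_smul, smul_eq_mul]
  rw [dotProduct_comm y v]
  ring

theorem rankOneParam_ne_zero {v : Fin d → ℝ} (hv : ∑ i, v i = 0) (hne : v ≠ 0) (c : ℝ) :
    rankOneParam v hv c ≠ 0 := by
  intro h
  refine hne (funext fun i => ?_)
  have h1 : matPart (rankOneParam v hv c) i i = 0 := by rw [h]; rfl
  exact mul_self_eq_zero.1 h1

/-- If `v^T log z` equals `c` on the sample, the polynomial `c²/2 - (v^T y - c)²/2` attains its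
upper bound `c²/2` at every observation. The expectation of a nondegenerate polynomial stays
strictly below such a bound, so the two means cannot agree. -/
theorem condPosDef_of_meanParam_eq [NeZero d] (hd : 2 ≤ d) (hn : n ≠ 0) {a : Fin d → ℝ}
    (ha : ∀ i, 0 < a i) {z : Fin n → Fin d → ℝ} {θ : HRSpace d} (hθ : θ ∈ hrTheta d)
    (h : meanParam (hrBase a) suffStat θ = meanSuffStat z) : CondPosDef (logCov z) := by
  have := neZero_hrBase ha
  intro v hv hs
  by_contra! hle
  obtain ⟨c, hc⟩ := const_of_logCov_quadForm hn hle
  have hθ' : natParam (hrBase a) suffStat ∈ 𝓝 θ := by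
    rw [natParam_hrBase hd ha]
    exact (isOpen_hrTheta (by omega)).mem_nhds hθ
  have h1 := inner_meanParam_lt measurable_suffStat (nondegenerateStat_suffStat ha) hθ'
    (rankOneParam_ne_zero hs hv c) (k := c ^ 2 / 2) (ae_of_all _ fun x => by
      rw [inner_suffStat, hrExponent_rankOneParam]
      linarith [sq_nonneg (v ⬝ᵥ logVec x - c)])
  rw [h, inner_meanSuffStat] at h1
  have hn' : (n : ℝ) ≠ 0 := Nat.cast_ne_zero.2 hn
  simp [hrExponent_rankOneParam, hc, hn'] at h1

theorem log_hrDensity [NeZero d] (hd : 2 ≤ d) {a : Fin d → ℝ} (ha : ∀ i, 0 < a i) {θ : HRSpace d}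
    (hθ : θ ∈ hrTheta d) {z : Fin d → ℝ} (hz : z ∈ hrRegion a) :
    Real.log (hrDensity a θ z) =
      ⟪θ, suffStat z⟫ - logPartition (hrBase a) suffStat θ + Real.log (∏ i, (z i)⁻¹) := by
  have := neZero_hrBase ha
  have hC : 0 < hrC a θ := by
    rw [hrC_eq]
    exact partition_pos (by rwa [natParam_hrBase hd ha])
  rw [hrDensity, Set.indicator_of_mem hz, hrKernel_eq, Real.log_mul (inv_pos.2 hC).ne'
    (mul_pos (Real.exp_pos _) (prod_inv_pos hz)).ne', Real.log_mul (Real.exp_pos _).ne'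
    (prod_inv_pos hz).ne', Real.log_exp, Real.log_inv, ← hrLogC_eq, hrLogC]
  ring

theorem hrLogLik_eq [NeZero d] (hd : 2 ≤ d) (hn : n ≠ 0) {a : Fin d → ℝ} (ha : ∀ i, 0 < a i)
    {z : Fin n → Fin d → ℝ} (hz : ∀ i, z i ∈ hrRegion a) :
    ∃ c, ∀ θ ∈ hrTheta d, hrLogLik a z θ =
      ⟪θ, meanSuffStat z⟫ - logPartition (hrBase a) suffStat θ + c := by
  have hn' : (n : ℝ) ≠ 0 := Nat.cast_ne_zero.2 hn
  refine ⟨(1 / (n : ℝ)) * ∑ i, Real.log (∏ k, (z i k)⁻¹), fun θ hθ => ?_⟩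
  rw [hrLogLik, Finset.sum_congr rfl fun i _ => log_hrDensity hd ha hθ (hz i),
    Finset.sum_add_distrib, Finset.sum_sub_distrib, mul_add, mul_sub, inner_meanSuffStat]
  simp only [inner_suffStat]
  simp [hn']

end Sample

end HueslerReissSample

/-! ### General position of independent absolutely continuous vectors. -/

section GeneralPosition

variable {d : ℕ}

/-- The vector `1_d` followed by the differences `yᵢ - y₀`. -/
def oneAndDifferences (y : ℕ → Fin d → ℝ) (i : ℕ) : Fin d → ℝ :=
  if i = 0 then fun _ => 1 else y i - y 0

theorem oneAndDifferences_congr {y y' : ℕ → Fin d → ℝ} {i : ℕ} (h : ∀ j ≤ i, y j = y' j) :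
    oneAndDifferences y i = oneAndDifferences y' i := by
  simp only [oneAndDifferences, h i le_rfl, h 0 (Nat.zero_le i)]

theorem volume_sub_mem_span_eq_zero {k : ℕ} (hk : k < d) (x : Fin k → Fin d → ℝ) (c : Fin d → ℝ) :
    volume {y : Fin d → ℝ | y - c ∈ Submodule.span ℝ (Set.range x)} = 0 := by
  set W := Submodule.span ℝ (Set.range x)
  have hW : W ≠ ⊤ := by
    intro h
    have h1 : Module.finrank ℝ W ≤ k := by
      have h2 := finrank_range_le_card (R := ℝ) x
      rwa [Fintype.card_fin] at h2
    rw [h, finrank_top, Module.finrank_fin_fun] at h1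
    omega
  have h := Measure.addHaar_submodule (volume : Measure (Fin d → ℝ)) W hW
  rw [← measure_preimage_add_right volume (-c)] at h
  simpa only [sub_eq_add_neg] using! h

variable {Ω : Type*} [MeasurableSpace Ω] {P : Measure Ω} [IsProbabilityMeasure P]

/-- Given the past, the next difference lies in the span of fewer than `d` vectors with probability
zero, as proper subspaces are Lebesgue null. Independence and Fubini's theorem make the conditioning
precise. -/
theorem ae_linearIndependent_oneAndDifferences {Y : ℕ → Ω → Fin d → ℝ}
    (hm : ∀ i, AEMeasurable (Y i) P) (hindep : iIndepFun Y P)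
    (hac : ∀ i, P.map (Y i) ≪ volume) (k : ℕ) (hk : k < d) :
    ∀ᵐ ω ∂P, LinearIndependent ℝ
      (fun i : Fin (k + 1) => oneAndDifferences (fun j => Y j ω) i) := by
  induction k with
  | zero =>
    refine ae_of_all _ fun ω => ?_
    have : Unique (Fin (0 + 1)) := inferInstanceAs (Unique (Fin 1))
    rw [linearIndependent_unique_iff]
    have : Nonempty (Fin d) := ⟨⟨0, hk⟩⟩
    intro h
    have := congrFun h ⟨0, hk⟩
    simp [oneAndDifferences] at this
  | succ k ih =>
    have ih := ih (by omega)
    -- The past is packed into a finite tuple `U`; `ext'` turns a tuple back into a sequence, with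
    -- the value 0 at indices that are never used.
    set S := Finset.range (k + 1)
    set ext' : (S → Fin d → ℝ) → ℕ → Fin d → ℝ := fun t i => if h : i ∈ S then t ⟨i, h⟩ else 0
    set prev : (S → Fin d → ℝ) → Fin (k + 1) → Fin d → ℝ := fun t i =>
      oneAndDifferences (ext' t) i
    set U : Ω → S → Fin d → ℝ := fun ω i => Y i ω
    have hext : ∀ i, Measurable fun t => ext' t i := by
      intro i
      simp only [ext']
      split_ifs <;> fun_prop
    have hprev : Measurable prev := by
      refine measurable_pi_iff.2 fun i => ?_
      simp only [prev, oneAndDifferences]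
      split_ifs
      · exact measurable_const
      · exact (hext _).sub (hext _)
    have hprevU : ∀ ω (i : Fin (k + 1)), prev (U ω) i = oneAndDifferences (fun j => Y j ω) i := by
      intro ω i
      refine oneAndDifferences_congr fun j hj => ?_
      have : j ∈ S := Finset.mem_range.2 (lt_of_le_of_lt hj i.2)
      simp only [ext', dif_pos this, U]
    set full : (S → Fin d → ℝ) × (Fin d → ℝ) → Fin (k + 2) → Fin d → ℝ := fun p =>
      Fin.snoc (prev p.1) (p.2 - ext' p.1 0)
    have hfull : Measurable full := by
      refine measurable_pi_iff.2 fun i => ?_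
      refine Fin.lastCases ?_ (fun i => ?_) i
      · simp only [full, Fin.snoc_last]
        exact measurable_snd.sub ((hext 0).comp measurable_fst)
      · simp only [full, Fin.snoc_castSucc]
        exact (measurable_pi_apply i).comp (hprev.comp measurable_fst)
    set D : Set ((S → Fin d → ℝ) × (Fin d → ℝ)) :=
      {p | LinearIndependent ℝ (prev p.1) ∧ ¬ LinearIndependent ℝ (full p)}
    have hD : MeasurableSet D :=
      ((hprev.comp measurable_fst) isOpen_setOfPred_linearIndependent.measurableSet).inter
        (hfull isOpen_setOfPred_linearIndependent.measurableSet).compl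
    have hUm : AEMeasurable U P := aemeasurable_pi_lambda _ fun i => hm i
    have hUY : IndepFun U (Y (k + 1)) P := by
      have h := hindep.indepFun_finset₀ S {k + 1} (by simp [S]) hm
      exact h.comp measurable_id (measurable_pi_apply (⟨k + 1, by simp⟩ : ({k + 1} : Finset ℕ)))
    have hprod := (indepFun_iff_map_prod_eq_prod_map_map hUm (hm (k + 1))).1 hUY
    have hprobU : IsProbabilityMeasure (P.map U) := Measure.isProbabilityMeasure_map hUm
    have hprobY : IsProbabilityMeasure (P.map (Y (k + 1))) :=
      Measure.isProbabilityMeasure_map (hm _)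
    have hnull : P.map (fun ω => (U ω, Y (k + 1) ω)) D = 0 := by
      rw [hprod, Measure.measure_prod_null hD]
      -- For a fixed past `t`, the section of the bad set is contained in a translate of a proper
      -- subspace, or is empty.
      refine ae_of_all _ fun t => hac (k + 1) ?_
      by_cases ht : LinearIndependent ℝ (prev t)
      · refine measure_mono_null (fun y hy => ?_)
          (volume_sub_mem_span_eq_zero hk (prev t) (ext' t 0))
        by_contra hspan
        exact hy.2 (linearIndependent_finSnoc.2 ⟨ht, hspan⟩)
      · have : Prod.mk t ⁻¹' D = ∅ := by
          ext y; simp [D, ht]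
        rw [this]
        exact measure_empty
    have hae : ∀ᵐ ω ∂P, (U ω, Y (k + 1) ω) ∉ D := by
      rw [Measure.map_apply_of_aemeasurable (hUm.prodMk (hm _)) hD] at hnull
      rw [ae_iff]
      simpa only [not_not] using! hnull
    filter_upwards [ih, hae] with ω h1 h2
    have h1' : LinearIndependent ℝ (prev (U ω)) := by
      convert! h1 using 1
      funext i
      exact hprevU ω i
    have h3 : LinearIndependent ℝ (full (U ω, Y (k + 1) ω)) := by
      by_contra h
      exact h2 ⟨h1', h⟩
    convert! h3 using 1
    funext i
    refine Fin.lastCases ?_ (fun i => ?_) i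
    · simp [full, oneAndDifferences, ext', U, S]
    · simp only [full, Fin.snoc_castSucc, hprevU]
      rfl

/-- A vector `v` of sum zero with `v^T V_n v ≤ 0` is orthogonal to `1_d` and to all differences of
log-observations. By independence these already span when there are `d` observations, so `v = 0`. -/
theorem condPosDef_of_linearIndependent {n : ℕ} (hd : d ≠ 0) (hn : d ≤ n) {y : ℕ → Fin d → ℝ}
    {z : Fin n → Fin d → ℝ} (hz : ∀ i, logVec (z i) = y i)
    (h : LinearIndependent ℝ (fun i : Fin d => oneAndDifferences y i)) :
    CondPosDef (logCov z) := by
  intro v hv hs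
  by_contra! hle
  obtain ⟨c, hc⟩ := const_of_logCov_quadForm (by omega) hle
  have hspan : Submodule.span ℝ (Set.range fun i : Fin d => oneAndDifferences y i) = ⊤ := by
    have : Nonempty (Fin d) := ⟨⟨0, by omega⟩⟩
    exact h.span_eq_top_of_card_eq_finrank (by simp)
  have hy : ∀ i : ℕ, i < n → v ⬝ᵥ y i = c := fun i hi => by
    rw [← hz ⟨i, hi⟩]; exact hc _
  have hzero : ∀ w ∈ Submodule.span ℝ (Set.range fun i : Fin d => oneAndDifferences y i),
      v ⬝ᵥ w = 0 := by
    intro w hw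
    induction hw using Submodule.span_induction with
    | mem w hw =>
      obtain ⟨i, rfl⟩ := hw
      simp only [oneAndDifferences]
      split_ifs
      · simpa [dotProduct] using hs
      · rw [dotProduct_sub, hy i (by omega), hy 0 (by omega), sub_self]
    | zero => simp
    | add a b _ _ ha hb => rw [dotProduct_add, ha, hb, add_zero]
    | smul r a _ ha => rw [dotProduct_smul, ha, smul_zero]
  refine hv (dotProduct_self_eq_zero.1 (hzero v ?_))
  rw [hspan]
  exact Submodule.mem_top

end GeneralPosition

theorem hasGradientAt_inner_sub {E : Type*} [NormedAddCommGroup E] [InnerProductSpace ℝ E]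
    [CompleteSpace E] {f : E → ℝ} {g θ : E} (h : HasGradientAt f g θ) (t : E) (c : ℝ) :
    HasGradientAt (fun η => ⟪η, t⟫ - f η + c) (t - g) θ := by
  rw [hasGradientAt_iff_hasFDerivAt] at h ⊢
  have h1 : HasFDerivAt (fun η : E => ⟪η, t⟫) (InnerProductSpace.toDual ℝ E t) θ := by
    refine (InnerProductSpace.toDual ℝ E t).hasFDerivAt.congr_of_eventuallyEq
      (Eventually.of_forall fun η => ?_)
    rw [InnerProductSpace.toDual_apply_apply, real_inner_comm]
  rw [map_sub]
  exact (h1.sub h).add_const c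

/-! ### The maximum likelihood estimator of the Hüsler–Reiss model. -/

section HueslerReissMLE

set_option linter.unusedSectionVars false

variable {d n : ℕ} [NeZero d] {a : Fin d → ℝ} {z : Fin n → Fin d → ℝ} {θ : HRSpace d}

theorem isOpen_natParam_hrBase (hd : 2 ≤ d) (ha : ∀ i, 0 < a i) :
    IsOpen (natParam (hrBase a) suffStat) := by
  rw [natParam_hrBase hd ha]
  exact isOpen_hrTheta (NeZero.ne d)

theorem natParam_hrBase_mem_nhds (hd : 2 ≤ d) (ha : ∀ i, 0 < a i) (hθ : θ ∈ hrTheta d) :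
    natParam (hrBase a) suffStat ∈ 𝓝 θ :=
  (isOpen_natParam_hrBase hd ha).mem_nhds (by rwa [natParam_hrBase hd ha])

theorem hasGradientAt_hrLogC (hd : 2 ≤ d) (ha : ∀ i, 0 < a i) (hθ : θ ∈ hrTheta d) :
    HasGradientAt (hrLogC a) (meanParam (hrBase a) suffStat θ) θ := by
  have := neZero_hrBase ha
  rw [hrLogC_eq]
  exact hasGradientAt_logPartition measurable_suffStat (natParam_hrBase_mem_nhds hd ha hθ)

theorem isScoreSolution_iff (hd : 2 ≤ d) (ha : ∀ i, 0 < a i) :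
    IsScoreSolution a z θ ↔
      θ ∈ hrTheta d ∧ meanParam (hrBase a) suffStat θ = meanSuffStat z := by
  refine and_congr_right fun hθ => ⟨fun h => ?_, fun h => ?_⟩
  · exact (hasGradientAt_hrLogC hd ha hθ).unique h
  · rw [← h]
    exact hasGradientAt_hrLogC hd ha hθ

/-- Θ is open, so a maximizer is a critical point; conversely the tangent inequality for `log C_a`
makes a critical point a global maximizer. -/
theorem isMLE_iff (hd : 2 ≤ d) (ha : ∀ i, 0 < a i) (hn : n ≠ 0) (hz : ∀ i, z i ∈ hrRegion a) :
    IsMLE a z θ ↔ θ ∈ hrTheta d ∧ meanParam (hrBase a) suffStat θ = meanSuffStat z := by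
  have := neZero_hrBase ha
  obtain ⟨c, hc⟩ := hrLogLik_eq hd hn ha hz
  refine and_congr_right fun hθ => ⟨fun h => ?_, fun h η hη => ?_⟩
  · have hg := hasGradientAt_inner_sub (hasGradientAt_hrLogC hd ha hθ) (meanSuffStat z) c
    have hU := (isOpen_hrTheta (NeZero.ne d)).mem_nhds hθ
    have hmax : IsLocalMax (fun η => ⟪η, meanSuffStat z⟫ - hrLogC a η + c) θ := by
      filter_upwards [hU] with η hη
      rw [hrLogC_eq, ← hc η hη, ← hc θ hθ]
      exact h hη
    have h0 := hmax.hasFDerivAt_eq_zero (hasGradientAt_iff_hasFDerivAt.1 hg)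
    exact (sub_eq_zero.1 ((LinearIsometryEquiv.map_eq_zero_iff _).1 h0)).symm
  · change hrLogLik a z η ≤ hrLogLik a z θ
    rw [hc η hη, hc θ hθ]
    rcases eq_or_ne η θ with rfl | hne
    · exact le_rfl
    have h1 := logPartition_gt_tangent measurable_suffStat (nondegenerateStat_suffStat ha)
      (natParam_hrBase_mem_nhds hd ha hθ) (by rwa [natParam_hrBase hd ha]) hne
    rw [h, inner_sub_left] at h1
    linarith

theorem isMLE_unique (hd : 2 ≤ d) (ha : ∀ i, 0 < a i) {η : HRSpace d}
    (hθ : θ ∈ hrTheta d ∧ meanParam (hrBase a) suffStat θ = meanSuffStat z)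
    (hη : η ∈ hrTheta d ∧ meanParam (hrBase a) suffStat η = meanSuffStat z) : η = θ := by
  have := neZero_hrBase ha
  rw [← natParam_hrBase hd ha] at hθ hη
  exact meanParam_injOn measurable_suffStat (nondegenerateStat_suffStat ha)
    (isOpen_natParam_hrBase hd ha) hη.1 hθ.1 (hη.2.trans hθ.2.symm)

theorem hrTheta_nonempty : (hrTheta d).Nonempty := by
  -- The centering projection `I - 1_d 1_d^T / d`, the identity on vectors of sum zero, paired with
  -- `-1_d`.
  let J : HRSpace d := ⟨WithLp.toLp 2 (Sum.elim
    (fun p => (if p.1 = p.2 then 1 else 0) - (d : ℝ)⁻¹) fun _ => -1), by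
      refine ⟨fun i j => ?_, fun i => ?_⟩
      · simp [eq_comm]
      · simp [Finset.sum_sub_distrib, NeZero.ne d]⟩
  refine ⟨J, (mem_hrTheta_iff (NeZero.ne d) J).2 ⟨fun v hv hs => ?_, ?_⟩⟩
  · have h : (matPart J).mulVec v = v := by
      ext i
      have : ∀ j, matPart J i j = (if i = j then 1 else 0) - (d : ℝ)⁻¹ := fun j => rfl
      simp [Matrix.mulVec, dotProduct, this, sub_mul, Finset.sum_sub_distrib, ← Finset.mul_sum, hs]
    rw [h]
    exact lt_of_le_of_ne (Finset.sum_nonneg fun i _ => mul_self_nonneg _)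
      fun h0 => hv (dotProduct_self_eq_zero.1 h0.symm)
  · have : ∀ k, vecPart J k = -1 := fun k => rfl
    simp [this, NeZero.pos d]

theorem exists_isMLE_iff (hd : 2 ≤ d) (ha : ∀ i, 0 < a i) (hn : n ≠ 0)
    (hz : ∀ i, z i ∈ hrRegion a) : (∃ θ, IsMLE a z θ) ↔ CondPosDef (logCov z) := by
  have := neZero_hrBase ha
  constructor
  · rintro ⟨θ, hθ⟩
    rw [isMLE_iff hd ha hn hz] at hθ
    exact condPosDef_of_meanParam_eq hd hn ha hθ.1 hθ.2
  · intro hV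
    obtain ⟨θ, hθ, hmax⟩ := exists_maximizer (ν := hrBase a) measurable_suffStat
      (t := meanSuffStat z) (by rw [natParam_hrBase hd ha]; exact hrTheta_nonempty)
      fun u hu => hrBase_pos_of_condPosDef hn ha hz hV hu
    rw [natParam_hrBase hd ha] at hθ hmax
    obtain ⟨c, hc⟩ := hrLogLik_eq hd hn ha hz
    refine ⟨θ, hθ, fun η hη => ?_⟩
    change hrLogLik a z η ≤ hrLogLik a z θ
    rw [hc η hη, hc θ hθ]
    linarith [hmax η hη]

theorem strictConcaveOn_hrLogLik (hd : 2 ≤ d) (ha : ∀ i, 0 < a i) (hn : n ≠ 0)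
    (hz : ∀ i, z i ∈ hrRegion a) : StrictConcaveOn ℝ (hrTheta d) (hrLogLik a z) := by
  have := neZero_hrBase ha
  obtain ⟨c, hc⟩ := hrLogLik_eq hd hn ha hz
  have hconv := convex_hrTheta (NeZero.ne d)
  have h := strictConvexOn_logPartition measurable_suffStat (nondegenerateStat_suffStat ha)
    (isOpen_natParam_hrBase hd ha) (by rwa [natParam_hrBase hd ha])
  rw [natParam_hrBase hd ha] at h
  refine ⟨hconv, fun θ hθ η hη hne s t hs ht hst => ?_⟩
  rw [hc θ hθ, hc η hη, hc _ (hconv hθ hη hs.le ht.le hst)]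
  have h1 := h.2 hθ hη hne hs ht hst
  have h2 : ⟪s • θ + t • η, meanSuffStat z⟫ =
      s * ⟪θ, meanSuffStat z⟫ + t * ⟪η, meanSuffStat z⟫ := by
    have e1 := real_inner_smul_left (F := HRSpace d) θ (meanSuffStat z) s
    have e2 := real_inner_smul_left (F := HRSpace d) η (meanSuffStat z) t
    rw [inner_add_left]
    exact congrArg₂ _ e1 e2
  rw [h2]
  simp only [smul_eq_mul] at h1 ⊢
  have h3 : s * c + t * c = c := by rw [← add_mul, hst, one_mul]
  simp only [mul_add, mul_sub] at h1 ⊢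
  linarith

/-- Both sides take the default value 0 when no estimator exists, so the identity holds for every
sample in the region and the delta method applies without discarding samples. -/
theorem mle_eq (hd : 2 ≤ d) (ha : ∀ i, 0 < a i) (hn : n ≠ 0) (hz : ∀ i, z i ∈ hrRegion a) :
    mle a z = meanParamInv (hrBase a) suffStat (meanSuffStat z) := by
  have := neZero_hrBase ha
  by_cases h : ∃ θ, IsMLE a z θ
  · have h1 := (isMLE_iff hd ha hn hz).1 h.choose_spec
    rw [mle, dif_pos h]
    conv_rhs => rw [← h1.2]
    exact (meanParamInv_meanParam measurable_suffStat (nondegenerateStat_suffStat ha)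
      (isOpen_natParam_hrBase hd ha) (by rw [natParam_hrBase hd ha]; exact h1.1)).symm
  · rw [mle, dif_neg h, meanParamInv, dif_neg]
    rintro ⟨θ, hθ, hT⟩
    rw [natParam_hrBase hd ha] at hθ
    exact h ⟨θ, (isMLE_iff hd ha hn hz).2 ⟨hθ, hT⟩⟩

theorem hasGradientAt_log_hrDensity (hd : 2 ≤ d) (ha : ∀ i, 0 < a i) (hθ : θ ∈ hrTheta d)
    {x : Fin d → ℝ} (hx : x ∈ hrRegion a) :
    HasGradientAt (fun η => Real.log (hrDensity a η x))
      (suffStat x - meanParam (hrBase a) suffStat θ) θ := by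
  have h := hasGradientAt_inner_sub (hasGradientAt_hrLogC hd ha hθ) (suffStat x)
    (Real.log (∏ i, (x i)⁻¹))
  rw [hasGradientAt_iff_hasFDerivAt] at h ⊢
  refine h.congr_of_eventuallyEq ?_
  filter_upwards [(isOpen_hrTheta (NeZero.ne d)).mem_nhds hθ] with η hη
  rw [log_hrDensity hd ha hη hx, hrLogC_eq]

theorem ae_hrPareto_mem (a : Fin d → ℝ) (θ : HRSpace d) :
    ∀ᵐ x ∂(hrPareto a θ), x ∈ hrRegion a := by
  rw [hrPareto_eq]
  exact (tilted_absolutelyContinuous _ _).ae_le (ae_hrBase_mem a)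

/-- The score is the statistic minus its mean, so the Fisher information is the covariance operator.
-/
theorem isFisherInformation_covOp (hd : 2 ≤ d) (ha : ∀ i, 0 < a i) (hθ : θ ∈ hrTheta d) :
    IsFisherInformation a θ (covOp (hrBase a) suffStat θ) := by
  have := neZero_hrBase ha
  have hT := measurable_suffStat (d := d)
  have hnhds := natParam_hrBase_mem_nhds hd ha hθ
  have hscore : ∀ᵐ x ∂(hrPareto a θ),
      hrScore a θ x = suffStat x - meanParam (hrBase a) suffStat θ := by
    filter_upwards [ae_hrPareto_mem a θ] with x hx
    exact (hasGradientAt_log_hrDensity hd ha hθ hx).gradient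
  refine ⟨?_, fun u v => ?_⟩
  · filter_upwards [ae_hrPareto_mem a θ] with x hx
    exact (hasGradientAt_log_hrDensity hd ha hθ hx).differentiableAt
  set m := meanParam (hrBase a) suffStat θ
  have hcongr : (fun x => ⟪u, hrScore a θ x⟫ * ⟪v, hrScore a θ x⟫) =ᵐ[hrPareto a θ]
      fun x => ⟪u, suffStat x - m⟫ * ⟪v, suffStat x - m⟫ := by
    filter_upwards [hscore] with x hx
    rw [hx]
  constructor
  · refine Integrable.congr ?_ hcongr.symm
    rw [hrPareto_eq]
    exact (((subexpGrowth_centered (T := suffStat) m).inner_left u).mul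
      ((subexpGrowth_centered (T := suffStat) m).inner_left v)).integrable_expFamily hT
      (by fun_prop : Measurable fun x : Fin d → ℝ =>
        ⟪u, suffStat x - m⟫ * ⟪v, suffStat x - m⟫).aestronglyMeasurable hnhds
  · rw [integral_congr_ae hcongr, hrPareto_eq, inner_covOp hT hnhds]

theorem meanSuffStat_eq (Z : ℕ → Fin d → ℝ) (n : ℕ) :
    meanSuffStat (fun i : Fin n => Z i) =
      (n : ℝ)⁻¹ • ∑ i ∈ Finset.range n, suffStat (Z i) := by
  rw [meanSuffStat, one_div, Finset.sum_range]

theorem map_logVec_hrPareto_absolutelyContinuous (ha : ∀ i, 0 < a i) (θ : HRSpace d) :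
    (hrPareto a θ).map logVec ≪ volume := by
  rw [hrPareto_eq]
  refine ((tilted_absolutelyContinuous (hrBase a) _).map measurable_logVec).trans ?_
  rw [map_logVec_hrBase ha]
  exact Measure.absolutelyContinuous_of_le Measure.restrict_le_self

variable {Ω : Type*} [MeasurableSpace Ω] {P : Measure Ω} [IsProbabilityMeasure P]
  {Z : ℕ → Ω → Fin d → ℝ}

theorem ae_forall_mem_hrRegion (hZ : ∀ i, HasLaw (Z i) (hrPareto a θ) P) :
    ∀ᵐ ω ∂P, ∀ i, Z i ω ∈ hrRegion a := by
  refine ae_all_iff.2 fun i => ?_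
  have h := ae_hrPareto_mem a θ
  rw [← (hZ i).map_eq] at h
  exact ae_of_ae_map (hZ i).aemeasurable h

theorem ae_existsUnique_isMLE (hd : 2 ≤ d) (ha : ∀ i, 0 < a i)
    (hZ : ∀ i, HasLaw (Z i) (hrPareto a θ) P) (hindep : iIndepFun Z P) (hn : d ≤ n) :
    ∀ᵐ ω ∂P, ∃! η, IsMLE a (fun i : Fin n => Z i ω) η := by
  have hli := ae_linearIndependent_oneAndDifferences (P := P) (Y := fun i ω => logVec (Z i ω))
    (fun i => measurable_logVec.comp_aemeasurable (hZ i).aemeasurable)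
    (hindep.comp (fun _ => logVec) fun _ => measurable_logVec) (fun i => by
      have h := map_logVec_hrPareto_absolutelyContinuous ha θ
      rw [← (hZ i).map_eq, AEMeasurable.map_map_of_aemeasurable measurable_logVec.aemeasurable
        (hZ i).aemeasurable] at h
      exact h) (d - 1) (by omega)
  -- The vector `1_d` and `d - 1` differences make `d` vectors, which use only the first `d`
  -- observations.
  rw [Nat.sub_add_cancel (by omega)] at hli
  filter_upwards [hli, ae_forall_mem_hrRegion hZ] with ω h1 h2
  have hV := condPosDef_of_linearIndependent (z := fun i : Fin n => Z i ω) (NeZero.ne d) hn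
    (fun i => rfl) h1
  have hz : ∀ i : Fin n, Z i ω ∈ hrRegion a := fun i => h2 i
  have hn0 : n ≠ 0 := by omega
  obtain ⟨η, hη⟩ := (exists_isMLE_iff hd ha hn0 hz).2 hV
  exact ⟨η, hη, fun η' hη' => isMLE_unique hd ha ((isMLE_iff hd ha hn0 hz).1 hη)
    ((isMLE_iff hd ha hn0 hz).1 hη')⟩

theorem tendstoInDistribution_mle (hd : 2 ≤ d) (ha : ∀ i, 0 < a i) (hθ : θ ∈ hrTheta d)
    {J : HRSpace d ≃L[ℝ] HRSpace d}
    (hJ : (J : HRSpace d →L[ℝ] HRSpace d) = covOp (hrBase a) suffStat θ)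
    {G : Measure (HRSpace d)} [IsGaussian G] (hG0 : ∫ x, x ∂G = 0)
    (hG : ∀ u v, covarianceBilin G u v = ⟪u, J v⟫)
    (hZ : ∀ i, HasLaw (Z i) (hrPareto a θ) P) (hindep : iIndepFun Z P) :
    TendstoInDistribution
      (fun (n : ℕ) (ω : Ω) => √(n : ℝ) • (mle a (fun i : Fin n => Z i ω) - θ))
      atTop id (fun _ => P) (G.map (J.symm : HRSpace d →L[ℝ] HRSpace d)) := by
  have := neZero_hrBase ha
  have h := tendstoInDistribution_meanParamInv measurable_suffStat (nondegenerateStat_suffStat ha)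
    (isOpen_natParam_hrBase hd ha) (by rwa [natParam_hrBase hd ha]) hJ hG0 hG
    (fun i => by rw [← hrPareto_eq]; exact hZ i) hindep
  refine h.congr (fun n => ?_) (ae_of_all _ fun _ => rfl)
  filter_upwards [ae_forall_mem_hrRegion hZ] with ω hω
  -- For `n = 0` the factor `√0` makes both sides zero.
  rcases Nat.eq_zero_or_pos n with rfl | hn
  · simp
  · rw [mle_eq hd ha hn.ne' fun i : Fin n => hω i, meanSuffStat_eq (fun i => Z i ω)]

end HueslerReissMLE

end

theorem mainTheorem2 (d : ℕ) (hd : 2 ≤ d) (a : Fin d → ℝ) (ha : ∀ i, 0 < a i) :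
    -- (i) strict concavity, existence and uniqueness
    (∀ (n : ℕ), 1 ≤ n → ∀ (z : Fin n → Fin d → ℝ), (∀ i, z i ∈ hrRegion a) →
      StrictConcaveOn ℝ (hrTheta d) (hrLogLik a z) ∧
      ((∃ θ, IsMLE a z θ) ↔ CondPosDef (logCov z)) ∧
      (∀ θ, IsMLE a z θ → IsScoreSolution a z θ ∧ ∀ η, IsScoreSolution a z η → η = θ)) ∧
    -- (ii) almost sure existence and uniqueness, asymptotic normality and efficiency
    (∀ θ ∈ hrTheta d,
      ContDiffAt ℝ 2 (hrLogC a) θ ∧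
      ∃ (J : HRSpace d ≃L[ℝ] HRSpace d) (G : ProbabilityMeasure (HRSpace d)),
        HasFDerivAt (gradient (hrLogC a)) (J : HRSpace d →L[ℝ] HRSpace d) θ ∧
        IsFisherInformation a θ (J : HRSpace d →L[ℝ] HRSpace d) ∧
        IsCenteredGaussian (G : Measure (HRSpace d)) (J.symm : HRSpace d →L[ℝ] HRSpace d) ∧
        ∀ (Ω : Type*) [MeasurableSpace Ω] (P : Measure Ω) [IsProbabilityMeasure P]
          (Z : ℕ → Ω → Fin d → ℝ),
          (∀ i, HasLaw (Z i) (hrPareto a θ) P) → iIndepFun Z P →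
          (∀ n : ℕ, d ≤ n → ∀ᵐ ω ∂P, ∃! η, IsMLE a (fun i : Fin n => Z i ω) η) ∧
          TendstoInDistribution
            (fun (n : ℕ) (ω : Ω) => √(n : ℝ) • (mle a (fun i : Fin n => Z i ω) - θ))
            atTop id (fun _ => P) (G : Measure (HRSpace d))) := by
  have : NeZero d := ⟨by omega⟩
  have := neZero_hrBase ha
  refine ⟨fun n hn z hz => ?_, fun θ hθ => ?_⟩
  · have hn0 : n ≠ 0 := by omega
    refine ⟨strictConcaveOn_hrLogLik hd ha hn0 hz, exists_isMLE_iff hd ha hn0 hz, fun θ hθ => ?_⟩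
    rw [isMLE_iff hd ha hn0 hz] at hθ
    exact ⟨(isScoreSolution_iff hd ha).2 hθ, fun η hη =>
      isMLE_unique hd ha hθ ((isScoreSolution_iff hd ha).1 hη)⟩
  · have hT := measurable_suffStat (d := d)
    have hnd := nondegenerateStat_suffStat ha
    have hnhds := natParam_hrBase_mem_nhds hd ha hθ
    obtain ⟨J, hJ⟩ := exists_equiv_covOp hT hnd hnhds
    have hJ' : ∀ u, J u = covOp (hrBase a) suffStat θ u := fun u => by rw [← hJ]; rfl
    -- This Gaussian has covariance `J` and is the limit for the averaged statistic; the limit law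
    -- of the estimator is its image under `J⁻¹`.
    obtain ⟨G, hGg, hG0, hG⟩ := exists_centeredGaussian (covOp (hrBase a) suffStat θ)
      (covOp_symm hT hnhds) (covOp_nonneg hT hnhds)
    simp only [← hJ'] at hG
    have hcov := centeredGaussian_map_symm (J := J) (fun u v => by
      rw [hJ', hJ', covOp_symm hT hnhds]) hG0 hG
    refine ⟨?_, J, ⟨G.map (J.symm : HRSpace d →L[ℝ] HRSpace d), inferInstance⟩, ?_, ?_,
      ⟨inferInstanceAs (IsGaussian (G.map (J.symm : HRSpace d →L[ℝ] HRSpace d))), hcov⟩,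
      fun Ω _ P _ Z hZ hindep => ⟨fun n hn => ae_existsUnique_isMLE hd ha hZ hindep hn,
        tendstoInDistribution_mle hd ha hθ hJ hG0 hG hZ hindep⟩⟩
    · rw [hrLogC_eq]
      exact contDiffAt_logPartition hT (isOpen_natParam_hrBase hd ha)
        (by rwa [natParam_hrBase hd ha])
    · rw [hJ]
      refine (hasFDerivAt_meanParam hT hnhds).congr_of_eventuallyEq ?_
      filter_upwards [(isOpen_hrTheta (NeZero.ne d)).mem_nhds hθ] with η hη
      exact (hasGradientAt_hrLogC hd ha hη).gradient
    · rw [hJ]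
      exact isFisherInformation_covOp hd ha hθ
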